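/- Let $M$ be a compact Kähler manifold with complex structure $J$, Kähler metric $g$ and Kähler form $\omega$, where $\omega(Jv,w)=g(v,w)$. Let $K$ be a compact connected Lie group with Lie algebra $\mathfrak k$ acting smoothly on $M$ by isometries of $g$. Fix an $\mathrm{Ad}(K)$-invariant scalar product $\langle\cdot,\cdot\rangle$ on $\mathfrak k$, with induced norm $\|\cdot\|$, and use it to identify $\mathfrak k\cong\mathfrak k^*$. Suppose that the action is Hamiltonian with moment map $\mu$, that is, $\mu:M\to\mathfrak k$ is a smooth map with $$\langle d\mu_x(X),\xi\rangle=\omega_x(X,\hat\xi_x)\qquad\text{for all }x\in M,\ X\in T_xM,\ \xi\in\mathfrak k,$$ where $\hat\xi$ denotes the fundamental vector field $\hat\xi_x=\frac{d}{dt}\big|_{t=0}\exp(t\xi)\cdot x$. If a point $x\in M$ realizes the maximum of $\|\mu\|^2$ on $M$, then the orbit $K\cdot x$ is a complex submanifold of $M$. -/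

import Mathlib

open scoped Manifold ContDiff

/-- A complex manifold (modelled on a complex normed space `E`, with holomorphic transition maps)
is a smooth real manifold, with the same atlas. -/
instance ComplexManifold.isManifold_real (E : Type*) [NormedAddCommGroup E] [NormedSpace ℂ E]
    (M : Type*) [TopologicalSpace M] [ChartedSpace E M] [IsManifold 𝓘(ℂ, E) ∞ M] :
    IsManifold 𝓘(ℝ, E) ∞ M := by
  refine isManifold_of_contDiffOn 𝓘(ℝ, E) ∞ M ?_
  intro e e' he he'
  have h := HasGroupoid.compatible (G := contDiffGroupoid ∞ 𝓘(ℂ, E)) he he'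
  rw [contDiffGroupoid, mem_groupoid_of_pregroupoid] at h
  exact ContDiffOn.restrict_scalars ℝ h.1

noncomputable section

/-- The complex structure `J` of a complex manifold, acting on the real tangent space at `x`:
multiplication by `i`.  (It does not depend on the chart at `x` that identifies the tangent space
with `E`, since the transition maps have complex linear derivatives.) -/
def complexStructure (E : Type*) [NormedAddCommGroup E] [NormedSpace ℂ E]
    {M : Type*} [TopologicalSpace M] [ChartedSpace E M] (x : M) :
    TangentSpace 𝓘(ℝ, E) x →L[ℝ] TangentSpace 𝓘(ℝ, E) x :=
  show E →L[ℝ] E from (Complex.I • ContinuousLinearMap.id ℂ E).restrictScalars ℝ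

theorem complexStructure_sq (E : Type*) [NormedAddCommGroup E] [NormedSpace ℂ E]
    {M : Type*} [TopologicalSpace M] [ChartedSpace E M] (x : M) (v : TangentSpace 𝓘(ℝ, E) x) :
    complexStructure E x (complexStructure E x v) = -v := by
  have h (u : E) : Complex.I • (Complex.I • u) = -u := by
    rw [smul_smul, Complex.I_mul_I, neg_one_smul]
  exact h v

/-- A (smooth) Hermitian metric on a complex manifold: a smooth Riemannian metric `g` with
`g (J v) (J w) = g v w`. -/
structure HermitianMetric (E : Type*) [NormedAddCommGroup E] [NormedSpace ℂ E]
    (M : Type*) [TopologicalSpace M] [ChartedSpace E M] [IsManifold 𝓘(ℂ, E) ∞ M] extends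
    Bundle.ContMDiffRiemannianMetric 𝓘(ℝ, E) ∞ E (fun x : M => TangentSpace 𝓘(ℝ, E) x) where
  inner_complexStructure (x : M) (v w : TangentSpace 𝓘(ℝ, E) x) :
    inner x (complexStructure E x v) (complexStructure E x w) = inner x v w

namespace HermitianMetric

variable {E : Type*} [NormedAddCommGroup E] [NormedSpace ℂ E]
  {M : Type*} [TopologicalSpace M] [ChartedSpace E M] [IsManifold 𝓘(ℂ, E) ∞ M]

theorem inner_self_complexStructure (g : HermitianMetric E M) (x : M)
    (v : TangentSpace 𝓘(ℝ, E) x) : g.inner x v (complexStructure E x v) = 0 := by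
  have h := g.inner_complexStructure x v (complexStructure E x v)
  rw [complexStructure_sq, map_neg, g.symm] at h
  linarith

/-- The fundamental `2`-form `ω (v, w) = g (v, J w)`, so that `ω (J v, w) = g (v, w)`. -/
def form (g : HermitianMetric E M) (x : M) : TangentSpace 𝓘(ℝ, E) x [⋀^Fin 2]→L[ℝ] ℝ where
  toFun v := g.inner x (v 0) (complexStructure E x (v 1))
  map_update_add' v i a b := by
    fin_cases i <;> simp [Function.update]
  map_update_smul' v i c a := by
    fin_cases i <;> simp [Function.update]
  map_eq_zero_of_eq' v i j hij hne := by
    have h : v 0 = v 1 := by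
      fin_cases i <;> fin_cases j <;> first | exact absurd rfl hne | exact hij | exact hij.symm
    change g.inner x (v 0) (complexStructure E x (v 1)) = 0
    rw [h]
    exact g.inner_self_complexStructure x (v 1)
  cont := by
    change Continuous fun v : Fin 2 → TangentSpace 𝓘(ℝ, E) x =>
      g.inner x (v 0) (complexStructure E x (v 1))
    have h (b : E →L[ℝ] E →L[ℝ] ℝ) (j : E →L[ℝ] E) :
        Continuous fun v : Fin 2 → E => b (v 0) (j (v 1)) := by
      fun_prop
    exact h (g.inner x) (complexStructure E x)

/-- The fundamental form read in the preferred chart `φ` at `x₀`: the pull-back of `ω` under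
`φ⁻¹`, a differential form on (the open subset `φ.target` of) the vector space `E`. -/
def formInChart (g : HermitianMetric E M) (x₀ : M) (y : E) : E [⋀^Fin 2]→L[ℝ] ℝ :=
  (g.form ((extChartAt 𝓘(ℝ, E) x₀).symm y)).compContinuousLinearMap
    (mfderiv 𝓘(ℝ, E) 𝓘(ℝ, E) (extChartAt 𝓘(ℝ, E) x₀).symm y)

end HermitianMetric

/-- A Kähler metric on a complex manifold: a Hermitian metric whose fundamental form is closed. -/
structure KahlerMetric (E : Type*) [NormedAddCommGroup E] [NormedSpace ℂ E]
    (M : Type*) [TopologicalSpace M] [ChartedSpace E M] [IsManifold 𝓘(ℂ, E) ∞ M] extends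
    HermitianMetric E M where
  closed (x₀ : M) (y : E) (hy : y ∈ (extChartAt 𝓘(ℝ, E) x₀).target) :
    extDeriv (toHermitianMetric.formInChart x₀) y = 0

/-- A subset `S` of a complex manifold is a (pure-dimensional, embedded) complex submanifold if
around every point of `S` there is a holomorphic chart of the manifold that maps `S` onto a complex
linear subspace `L` of the model space. -/
def IsComplexSubmanifold (E : Type*) [NormedAddCommGroup E] [NormedSpace ℂ E]
    {M : Type*} [TopologicalSpace M] [ChartedSpace E M] (S : Set M) : Prop :=
  ∃ L : Submodule ℂ E, ∀ p ∈ S, ∃ φ ∈ IsManifold.maximalAtlas 𝓘(ℂ, E) ∞ M,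
    p ∈ φ.source ∧ φ '' (φ.source ∩ S) = φ.target ∩ (L : Set E)

/-- The adjoint action of `k` on the Lie algebra `T₁K`: the derivative at `1` of `h ↦ k h k⁻¹`. -/
def adjointAction (F : Type*) [NormedAddCommGroup F] [NormedSpace ℝ F]
    {K : Type*} [TopologicalSpace K] [ChartedSpace F K] [Group K] (k : K) :
    GroupLieAlgebra 𝓘(ℝ, F) K → GroupLieAlgebra 𝓘(ℝ, F) K :=
  fun ξ => (mfderiv 𝓘(ℝ, F) 𝓘(ℝ, F) (fun h : K => k * h * k⁻¹) 1 ξ : F)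

/-- `B` is an `Ad(K)`-invariant scalar product on the Lie algebra of `K`. -/
structure IsInvariantScalarProduct (F : Type*) [NormedAddCommGroup F] [NormedSpace ℝ F]
    (K : Type*) [TopologicalSpace K] [ChartedSpace F K] [Group K]
    (B : LinearMap.BilinForm ℝ (GroupLieAlgebra 𝓘(ℝ, F) K)) : Prop where
  symm (ξ η : GroupLieAlgebra 𝓘(ℝ, F) K) : B ξ η = B η ξ
  pos (ξ : GroupLieAlgebra 𝓘(ℝ, F) K) (hξ : ξ ≠ 0) : 0 < B ξ ξ
  invariant (k : K) (ξ η : GroupLieAlgebra 𝓘(ℝ, F) K) :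
    B (adjointAction F k ξ) (adjointAction F k η) = B ξ η

/-- The fundamental vector field of `ξ` at `x`, that is the velocity at `t = 0` of
`t ↦ exp (t ξ) • x`; by the chain rule it is the image of `ξ` under the derivative at `1` of the
orbit map `k ↦ k • x`. -/
def fundamentalField (F E : Type*) [NormedAddCommGroup F] [NormedSpace ℝ F]
    [NormedAddCommGroup E] [NormedSpace ℂ E]
    {K : Type*} [TopologicalSpace K] [ChartedSpace F K] [Group K]
    {M : Type*} [TopologicalSpace M] [ChartedSpace E M] [MulAction K M]
    (ξ : GroupLieAlgebra 𝓘(ℝ, F) K) (x : M) : TangentSpace 𝓘(ℝ, E) x :=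
  (mfderiv 𝓘(ℝ, F) 𝓘(ℝ, E) (fun k : K => k • x) 1 ξ : E)

/-- The action of `K` is by isometries of the metric `g`. -/
def IsIsometricAction {E : Type*} [NormedAddCommGroup E] [NormedSpace ℂ E]
    (K : Type*) [Group K]
    {M : Type*} [TopologicalSpace M] [ChartedSpace E M] [IsManifold 𝓘(ℂ, E) ∞ M] [MulAction K M]
    (g : HermitianMetric E M) : Prop :=
  ∀ (k : K) (x : M) (v w : TangentSpace 𝓘(ℝ, E) x),
    g.inner (k • x) (mfderiv 𝓘(ℝ, E) 𝓘(ℝ, E) (fun y : M => k • y) x v)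
      (mfderiv 𝓘(ℝ, E) 𝓘(ℝ, E) (fun y : M => k • y) x w) = g.inner x v w

/-- `ν : M → 𝔨*` is a moment map for the action of `K`: it is smooth and
`dν_x (X) (ξ) = ω_x (X, ξ̂_x)`.  (Since `𝔨*` is a finite-dimensional vector space, both are
expressed through the components `y ↦ ν y ξ`.) -/
structure IsMomentMap (F : Type*) [NormedAddCommGroup F] [NormedSpace ℝ F]
    {E : Type*} [NormedAddCommGroup E] [NormedSpace ℂ E]
    {K : Type*} [TopologicalSpace K] [ChartedSpace F K] [Group K]
    {M : Type*} [TopologicalSpace M] [ChartedSpace E M] [IsManifold 𝓘(ℂ, E) ∞ M] [MulAction K M]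
    (g : HermitianMetric E M) (ν : M → Module.Dual ℝ (GroupLieAlgebra 𝓘(ℝ, F) K)) : Prop where
  smooth (ξ : GroupLieAlgebra 𝓘(ℝ, F) K) :
    ContMDiff 𝓘(ℝ, E) 𝓘(ℝ, ℝ) ∞ (fun y : M => ν y ξ)
  deriv (ξ : GroupLieAlgebra 𝓘(ℝ, F) K) (x : M) (X : TangentSpace 𝓘(ℝ, E) x) :
    mfderiv 𝓘(ℝ, E) 𝓘(ℝ, ℝ) (fun y : M => ν y ξ) x X
      = g.form x ![X, fundamentalField F E ξ x]

end

/-!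
Let `β = μ x` and let `μ^η = ⟨μ, η⟩` be the component of the moment map along `η`. As `‖μ‖ ≤ ‖β‖`,
the Cauchy-Schwarz inequality (`sq_apply_le_of_pos`) gives `(μ^η - μ^η x)² ≤ 2 ‖η‖² (μ^β x - μ^β)`
for every `η`. Hence `μ^β` is maximal at `x`, so that the fundamental field of `β` vanishes at `x`;
let `A` be its linearization, an endomorphism of the tangent space of `M` at `x`. The action is
isometric, so `A` is skew. The Hessian of `μ^β` at `x` is `g (v, J A w)`; it is symmetric, so `A`
commutes with `J`; it is negative semidefinite; and by the inequality (`two_mul_sq_fderiv_le`) its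
null vectors are null vectors of every `dμ^η`, which makes them orthogonal to the tangent space `T`
of the orbit. Moreover `A` preserves `T` (`linearizedAction_mem_range`). Now `-J A` is positive
semidefinite with square `-A²`, so it is the square root of `-A²` and is definite on `T`. On
eigenvectors of `-A²` in `T`, the operators `A` and `J` agree up to a non-zero factor, hence `T` is
invariant under `J` (`complex_invariant_of_inner`, `orbit_tangent_complex_of_isMax`).

The fundamental fields are Hamiltonian, so they preserve the closed form `ω`
(`lieDerivative_eq_zero`). The connected group `K` therefore preserves `ω` as well as `g`, hence it
acts by holomorphic maps (`modelDeriv_smul_complex`). Consequently all tangent spaces of the orbit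
are complex, and the orbit map, which has constant rank, parametrizes locally the graph of a
holomorphic map (`exists_holomorphic_straightening`). As `K` is compact, the orbit has no further
points near `x`, and translating a slice chart at `x` gives slice charts everywhere
(`isComplexSubmanifold_orbit`).

Only the local group law in a chart at `1` is used, rather than the exponential map and the
bracket, and derivatives at different points are compared through `modelDeriv`, the derivative of a
map of manifolds as a linear map of the model spaces.
-/

open Filter Topology

set_option linter.unusedSectionVars false

/-! ### Linear algebra and calculus in vector spaces -/

/-- A spectral argument. Let `A` be skew and commute with the orthogonal complex structure `J`, so
that `J A` is symmetric and `(J A)² = -A²`. If `J A ≤ 0`, then `-J A` is the positive square root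
of `-A²`; if moreover the null vectors of `J A` are orthogonal to the `A`-invariant subspace `T`,
then on an eigenvector `e ∈ T` of `-A²` with eigenvalue `s²` one has `A e = s J e` with `s ≠ 0`,
whence `J e = s⁻¹ A e ∈ T`. Such eigenvectors span `T`. -/
theorem complex_invariant_of_inner {V : Type*} [NormedAddCommGroup V] [InnerProductSpace ℝ V]
    [FiniteDimensional ℝ V] (A J : V →ₗ[ℝ] V) (T : Submodule ℝ V)
    (hA : ∀ v w, inner ℝ (A v) w = -inner ℝ v (A w))
    (hJ : ∀ v w, inner ℝ (J v) w = -inner ℝ v (J w))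
    (hJJ : ∀ v, J (J v) = -v) (hAJ : ∀ v, A (J v) = J (A v))
    (hT : ∀ v ∈ T, A v ∈ T)
    (hnn : ∀ v, inner ℝ v (J (A v)) ≤ 0)
    (hker : ∀ v, inner ℝ v (J (A v)) = 0 → ∀ w ∈ T, inner ℝ v w = 0) :
    ∀ v ∈ T, J v ∈ T := by
  have hAA : ∀ v ∈ T, (-(A ∘ₗ A)) v ∈ T := fun v hv => T.neg_mem (hT _ (hT v hv))
  have hsymm : ((-(A ∘ₗ A)).restrict hAA).IsSymmetric := by
    rintro ⟨v, hv⟩ ⟨w, hw⟩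
    simp [hA]
  -- `T` is spanned by eigenvectors of `-A²`, so it suffices to treat these
  have key : ∀ (c : ℝ) (e : V), e ∈ T → A (A e) = -(c • e) → J e ∈ T := by
    intro c e he hce
    by_cases he0 : e = 0
    · simp [he0]
    have hpos : 0 < inner ℝ e e := real_inner_self_pos.2 he0
    have hc : 0 ≤ c := by
      have h1 : inner ℝ (A e) (A e) = c * inner ℝ e e := by
        rw [hA, hce, inner_neg_right, inner_smul_right, neg_neg]
      have h2 : 0 ≤ inner ℝ (A e) (A e) := real_inner_self_nonneg
      by_contra hcon
      nlinarith
    set s := Real.sqrt c with hs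
    have hss : s * s = c := Real.mul_self_sqrt hc
    have hs0 : 0 ≤ s := Real.sqrt_nonneg c
    -- `w = (-J A - s) e` satisfies `J A w = s w`, which `J A ≤ 0` allows only if `J A w = 0`
    set w := -J (A e) - s • e with hw
    have hJAw : J (A w) = s • w := by
      simp only [hw, map_sub, map_neg, map_smul, hAJ, hJJ, hce, smul_sub, smul_smul, hss, smul_neg]
      abel
    have hwz : J (A w) = 0 := by
      have h1 := hnn w
      rw [hJAw, inner_smul_right] at h1
      have h2 : 0 ≤ inner ℝ w w := real_inner_self_nonneg
      have h3 : s * inner ℝ w w = 0 := le_antisymm h1 (mul_nonneg hs0 h2)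
      rcases mul_eq_zero.1 h3 with h4 | h4
      · rw [hJAw, h4, zero_smul]
      · rw [inner_self_eq_zero.1 h4, map_zero, map_zero]
    -- `s = 0` would make `e ∈ T` a null vector of `J A`, orthogonal to itself
    by_cases hs1 : s = 0
    · exfalso
      have h1 : J (A e) = 0 := by
        have h2 : inner ℝ (J (A e)) (J (A e)) = 0 := by
          rw [hJ, hJJ, inner_neg_right, neg_neg, hA, hce, ← hss, hs1]
          simp
        exact inner_self_eq_zero.1 h2
      have := hker e (by rw [h1, inner_zero_right]) e he
      exact hpos.ne' this
    · have h1 : w = 0 := by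
        rw [hwz] at hJAw
        exact (smul_eq_zero.1 hJAw.symm).resolve_left hs1
      have h2 : J (A e) = -(s • e) := by
        rw [hw] at h1
        rw [← sub_eq_zero.1 h1, neg_neg]
      have h3 : A e = s • J e := by
        have h4 := congrArg J h2
        rw [hJJ, map_neg, map_smul] at h4
        exact neg_injective h4
      have h4 : J e = s⁻¹ • A e := by rw [h3, smul_smul, inv_mul_cancel₀ hs1, one_smul]
      rw [h4]
      exact T.smul_mem _ (hT e he)
  intro v hv
  let b := hsymm.eigenvectorBasis rfl
  have hb : ∀ i, J (b i : V) ∈ T := by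
    intro i
    refine key (hsymm.eigenvalues rfl i) (b i) (b i).2 ?_
    have := congrArg Subtype.val (hsymm.apply_eigenvectorBasis rfl i)
    simp only [LinearMap.coe_restrict_apply] at this
    simp only [LinearMap.neg_apply, LinearMap.comp_apply] at this
    rw [← neg_eq_iff_eq_neg]
    simpa using this
  have hsum := b.sum_repr ⟨v, hv⟩
  have hsum' : v = ∑ i, b.repr ⟨v, hv⟩ i • (b i : V) := by
    have := congrArg Subtype.val hsum
    simpa using this.symm
  rw [hsum', map_sum]
  exact T.sum_mem fun i _ => by rw [map_smul]; exact T.smul_mem _ (hb i)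

/-- The version of `complex_invariant_of_inner` for an inner product given as a bilinear form `G`
rather than as an instance. -/
theorem complex_invariant_of_form {V : Type*} [AddCommGroup V] [Module ℝ V]
    [FiniteDimensional ℝ V] (G : V →ₗ[ℝ] V →ₗ[ℝ] ℝ) (hsymm : ∀ v w, G v w = G w v)
    (hpos : ∀ v, v ≠ 0 → 0 < G v v) (A J : V →ₗ[ℝ] V) (T : Submodule ℝ V)
    (hA : ∀ v w, G (A v) w = -G v (A w))
    (hJ : ∀ v w, G (J v) w = -G v (J w))
    (hJJ : ∀ v, J (J v) = -v) (hAJ : ∀ v, A (J v) = J (A v))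
    (hT : ∀ v ∈ T, A v ∈ T)
    (hnn : ∀ v, G v (J (A v)) ≤ 0)
    (hker : ∀ v, G v (J (A v)) = 0 → ∀ w ∈ T, G v w = 0) :
    ∀ v ∈ T, J v ∈ T := by
  let core : InnerProductSpace.Core ℝ V :=
    { inner := fun v w => G v w
      conj_inner_symm := fun v w => by simpa using hsymm w v
      re_inner_nonneg := fun v => by
        rcases eq_or_ne v 0 with rfl | h
        · simp
        · simpa using (hpos v h).le
      add_left := fun u v w => by simp
      smul_left := fun u v r => by simp
      definite := fun v hv => by
        by_contra h
        exact (hpos v h).ne' hv }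
  let _ : NormedAddCommGroup V := core.toNormedAddCommGroup
  let _ : InnerProductSpace ℝ V := InnerProductSpace.ofCore core.toCore
  exact complex_invariant_of_inner A J T hA hJ hJJ hAJ hT hnn hker

theorem IsLocalMin.deriv_deriv_nonneg {b : ℝ → ℝ} {t : ℝ} (hb : ContDiffAt ℝ 2 b t)
    (h : IsLocalMin b t) : 0 ≤ deriv (deriv b) t := by
  by_contra! hneg
  have h1 : IsLocalMin (-b) t :=
    isLocalMin_of_deriv_deriv_pos (by simpa [deriv.neg'] using hneg)
      (by simpa using h.deriv_eq_zero) hb.continuousAt.neg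
  have h2 : b =ᶠ[𝓝 t] fun _ => b t := by
    filter_upwards [h, h1] with s hs hs'
    simp only [Pi.neg_apply] at hs'
    linarith
  have h3 := h2.deriv.deriv_eq
  simp at h3
  linarith

/-- If `(h - h p)² ≤ C (f p - f)` near `p`, then `2 (dh)² ≤ -C Hess f` at `p`: the function
`C (f p - f) - (h - h p)²` has a local minimum at `p`. In particular, for `C ≥ 0`, the null
vectors of the Hessian of `f` are null vectors of `dh`. -/
theorem two_mul_sq_fderiv_le {E : Type*} [NormedAddCommGroup E] [NormedSpace ℝ E]
    {f h : E → ℝ} {p : E} {C : ℝ} (hf : ContDiffAt ℝ 2 f p) (hh : ContDiffAt ℝ 2 h p)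
    (hle : ∀ᶠ q in 𝓝 p, (h q - h p) ^ 2 ≤ C * (f p - f q)) (v : E) :
    2 * (fderiv ℝ h p v) ^ 2 ≤ -(C * fderiv ℝ (fderiv ℝ f) p v v) := by
  set l : ℝ → E := fun t => p + t • v with hl
  have hl0 : l 0 = p := by simp [hl]
  have hlc : ContDiff ℝ 2 l := by fun_prop
  have hld : ∀ t, HasDerivAt l v t := fun t => by
    have h1 := ((hasDerivAt_id t).smul_const v).const_add p
    rw [one_smul] at h1
    exact h1
  have hlt : Tendsto l (𝓝 0) (𝓝 p) := by
    simpa [hl0] using hlc.continuous.tendsto 0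
  set b : ℝ → ℝ := fun t => C * (f p - f (l t)) - (h (l t) - h p) ^ 2 with hb
  have hfl : ContDiffAt ℝ 2 (fun t => f (l t)) 0 :=
    ContDiffAt.comp (0 : ℝ) (by rwa [hl0]) hlc.contDiffAt
  have hhl : ContDiffAt ℝ 2 (fun t => h (l t)) 0 :=
    ContDiffAt.comp (0 : ℝ) (by rwa [hl0]) hlc.contDiffAt
  have hbc : ContDiffAt ℝ 2 b 0 :=
    (contDiffAt_const.mul (contDiffAt_const.sub hfl)).sub ((hhl.sub contDiffAt_const).pow 2)
  have hmin : IsLocalMin b 0 := by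
    filter_upwards [hlt.eventually hle] with t ht
    simp only [hb, hl0, sub_self]
    linarith
  have hdiff : ∀ {g : E → ℝ}, ContDiffAt ℝ 2 g p → ∀ᶠ t in 𝓝 (0 : ℝ),
      HasDerivAt (fun t => g (l t)) (fderiv ℝ g (l t) v) t := by
    intro g hg
    filter_upwards [hlt.eventually (hg.eventually (by simp))] with t ht
    exact (ht.differentiableAt (by norm_num)).hasFDerivAt.comp_hasDerivAt t (hld t)
  have hderiv : deriv b =ᶠ[𝓝 0] fun t => -(C * fderiv ℝ f (l t) v)
      - 2 * ((h (l t) - h p) * fderiv ℝ h (l t) v) := by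
    filter_upwards [hdiff hf, hdiff hh] with t h1 h2
    have h3 := ((h1.const_sub (f p)).const_mul C).sub ((h2.sub_const (h p)).pow 2)
    refine HasDerivAt.deriv (h3.congr_deriv ?_)
    push_cast
    ring
  have hd2 : ∀ {g : E → ℝ}, ContDiffAt ℝ 2 g p →
      HasDerivAt (fun t => fderiv ℝ g (l t) v) (fderiv ℝ (fderiv ℝ g) p v v) 0 := by
    intro g hg
    have h1 : DifferentiableAt ℝ (fderiv ℝ g) (l 0) := by
      rw [hl0]
      exact (hg.fderiv_right (m := 1) (by norm_num)).differentiableAt (by norm_num)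
    have h2 : HasDerivAt (fun t => fderiv ℝ g (l t)) (fderiv ℝ (fderiv ℝ g) p v) 0 := by
      have h3 := h1.hasFDerivAt.comp_hasDerivAt (0 : ℝ) (hld 0)
      rwa [hl0] at h3
    simpa using h2.clm_apply (hasDerivAt_const (0 : ℝ) v)
  have h0 := hdiff hh
  have h1 : HasDerivAt (fun t => h (l t) - h p) (fderiv ℝ h p v) 0 := by
    simpa [hl0] using h0.self_of_nhds.sub_const (h p)
  have h2 := (((hd2 hf).const_mul C).neg).sub ((h1.mul (hd2 hh)).const_mul 2)
  have h3 := hmin.deriv_deriv_nonneg hbc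
  rw [hderiv.deriv_eq] at h3
  erw [h2.deriv] at h3
  simp only [hl0, sub_self, zero_mul, add_zero] at h3
  nlinarith

theorem two_le_infty : (2 : ℕ∞ω) ≤ ∞ := ENat.LEInfty.out

/-- A smooth map between complex vector spaces whose real derivative is complex linear is
holomorphic, and all its complex derivatives are again of this kind: the real second derivative is
complex linear in both arguments, by its symmetry. -/
theorem contDiffOn_complex_of_real {E : Type*} [NormedAddCommGroup E] [NormedSpace ℂ E]
    [FiniteDimensional ℂ E] {E' : Type*} [NormedAddCommGroup E'] [NormedSpace ℂ E']
    {s : Set E} (hs : IsOpen s) {f : E → E'} (hf : ContDiffOn ℝ ∞ f s)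
    (hl : ∀ x ∈ s, ∀ v, fderiv ℝ f x (Complex.I • v) = Complex.I • fderiv ℝ f x v) :
    ContDiffOn ℂ ∞ f s := by
  refine contDiffOn_infty.2 fun n => ?_
  induction n generalizing f with
  | zero => exact contDiffOn_zero.2 hf.continuousOn
  | succ n ih =>
    have hreal : ∀ x ∈ s, HasFDerivAt f (fderiv ℝ f x) x := fun x hx =>
      ((hf.contDiffAt (hs.mem_nhds hx)).differentiableAt (by simp)).hasFDerivAt
    have hcomplex : ∀ x ∈ s, ∃ D : E →L[ℂ] E', HasFDerivAt f D x := by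
      intro x hx
      have hsmul : ∀ (c : ℂ) v, fderiv ℝ f x (c • v) = c • fderiv ℝ f x v := by
        intro c v
        have h1 : c • v = c.re • v + c.im • (Complex.I • v) := by
          conv_lhs => rw [← Complex.re_add_im c]
          rw [add_smul, mul_smul, Complex.coe_smul, Complex.coe_smul]
        have h2 : c • fderiv ℝ f x v
            = c.re • fderiv ℝ f x v + c.im • (Complex.I • fderiv ℝ f x v) := by
          conv_lhs => rw [← Complex.re_add_im c]
          rw [add_smul, mul_smul, Complex.coe_smul, Complex.coe_smul]
        rw [h1, map_add, map_smul, map_smul, hl x hx, h2]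
      let D : E →L[ℂ] E' :=
        { toFun := fderiv ℝ f x
          map_add' := map_add _
          map_smul' := hsmul
          cont := (fderiv ℝ f x).cont }
      exact ⟨D, hasFDerivAt_of_restrictScalars ℝ (hreal x hx) (by ext v; rfl)⟩
    have hdiff : DifferentiableOn ℂ f s := fun x hx =>
      (hcomplex x hx).choose_spec.differentiableAt.differentiableWithinAt
    rw [Nat.cast_add, Nat.cast_one, contDiffOn_succ_iff_fderiv_of_isOpen hs]
    refine ⟨hdiff, fun h => by simp at h, contDiffOn_clm_apply.2 fun v => ?_⟩
    have heq : ∀ w, Set.EqOn (fun x => fderiv ℂ f x w) (fun x => fderiv ℝ f x w) s := by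
      intro w x hx
      have := (hdiff.differentiableAt (hs.mem_nhds hx)).fderiv_restrictScalars ℝ
      simp [this]
    have hD : ContDiffOn ℝ ∞ (fderiv ℝ f) s := ((contDiffOn_infty_iff_fderiv_of_isOpen hs).1 hf).2
    refine ContDiffOn.congr (ih (f := fun x => fderiv ℝ f x v) (hD.clm_apply contDiffOn_const) ?_)
      (heq v)
    intro x hx w
    have hfx : ContDiffAt ℝ ∞ f x := hf.contDiffAt (hs.mem_nhds hx)
    have hsymm : IsSymmSndFDerivAt ℝ f x := hfx.isSymmSndFDerivAt (by simpa using two_le_infty)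
    have hDx : DifferentiableAt ℝ (fderiv ℝ f) x :=
      (hD.contDiffAt (hs.mem_nhds hx)).differentiableAt (by simp)
    have hval : ∀ a b, fderiv ℝ (fun x => fderiv ℝ f x a) x b = fderiv ℝ (fderiv ℝ f) x b a := by
      intro a b
      have := (hDx.hasFDerivAt.clm_apply (hasFDerivAt_const a x)).fderiv
      rw [this]
      simp
    have hI : (fun x => fderiv ℝ f x (Complex.I • w)) =ᶠ[𝓝 x]
        fun x => Complex.I • fderiv ℝ f x w := by
      filter_upwards [hs.mem_nhds hx] with y hy using hl y hy w
    rw [hval, hval, hsymm, hsymm w, ← hval (Complex.I • w), hI.fderiv_eq, ← hval w]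
    have h1 : DifferentiableAt ℝ (fun x => fderiv ℝ f x w) x :=
      hDx.clm_apply (differentiableAt_const w)
    exact congrArg (fun D : E →L[ℝ] E' => D v) (fderiv_fun_const_smul h1 Complex.I)

/-! ### Second derivatives of a local action on a vector space -/

section
variable {E F : Type*} [NormedAddCommGroup E] [NormedSpace ℝ E] [NormedAddCommGroup F]
  [NormedSpace ℝ F]

/-- For a family `Ψ (u, ·)` of maps of `E` with `Ψ (u₀, ·) = id` near `p₀`, the linearization at
`q = (u₀, p₀)` of the infinitesimal action of `ξ`, that is, the derivative at `p₀` of the vector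
field `p ↦ ∂Ψ/∂u (u₀, p) ξ`. It is encoded as the mixed second derivative of `Ψ` at `q`. -/
noncomputable def linearizedAction (Ψ : F × E → E) (q : F × E) (ξ : F) : E →L[ℝ] E :=
  (fderiv ℝ (fderiv ℝ Ψ) q (ξ, 0)).comp (ContinuousLinearMap.inr ℝ F E)

theorem linearizedAction_apply (Ψ : F × E → E) (q : F × E) (ξ : F) (v : E) :
    linearizedAction Ψ q ξ v = fderiv ℝ (fderiv ℝ Ψ) q (ξ, 0) (0, v) := rfl

theorem hasFDerivAt_fderiv_apply_left {Ψ : F × E → E} {u₀ : F} {p₀ : E}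
    (hΨ : ContDiffAt ℝ 2 Ψ (u₀, p₀)) (v : E) :
    HasFDerivAt (fun u => fderiv ℝ Ψ (u, p₀) (0, v))
      (((fderiv ℝ (fderiv ℝ Ψ) (u₀, p₀)).flip (0, v)).comp (ContinuousLinearMap.inl ℝ F E)) u₀ := by
  have h1 : DifferentiableAt ℝ (fderiv ℝ Ψ) (u₀, p₀) :=
    (hΨ.fderiv_right (m := 1) (by norm_num)).differentiableAt (by norm_num)
  have h2 : HasFDerivAt (fun u : F => (u, p₀)) (ContinuousLinearMap.inl ℝ F E) u₀ :=
    hasFDerivAt_prodMk_left u₀ p₀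
  have h3 := (h1.hasFDerivAt.comp u₀ h2).clm_apply (hasFDerivAt_const ((0, v) : F × E) u₀)
  refine h3.congr_fderiv ?_
  ext ξ
  simp

theorem hasFDerivAt_fderiv_apply_right {Ψ : F × E → E} {u₀ : F} {p₀ : E}
    (hΨ : ContDiffAt ℝ 2 Ψ (u₀, p₀)) (ξ : F) :
    HasFDerivAt (fun p => fderiv ℝ Ψ (u₀, p) (ξ, 0)) (linearizedAction Ψ (u₀, p₀) ξ) p₀ := by
  have h1 : DifferentiableAt ℝ (fderiv ℝ Ψ) (u₀, p₀) :=
    (hΨ.fderiv_right (m := 1) (by norm_num)).differentiableAt (by norm_num)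
  have h2 : HasFDerivAt (fun p : E => (u₀, p)) (ContinuousLinearMap.inr ℝ F E) p₀ :=
    hasFDerivAt_prodMk_right u₀ p₀
  have h3 := (h1.hasFDerivAt.comp p₀ h2).clm_apply (hasFDerivAt_const ((ξ, 0) : F × E) p₀)
  refine h3.congr_fderiv ?_
  ext v
  have hs := hΨ.isSymmSndFDerivAt (by simp)
  simp [linearizedAction_apply, hs.eq (ξ, 0) (0, v)]

theorem fderiv_inr_of_eventually_eq {Ψ : F × E → E} {u₀ : F} {p₀ : E}
    (hΨ : DifferentiableAt ℝ Ψ (u₀, p₀)) (hid : ∀ᶠ p in 𝓝 p₀, Ψ (u₀, p) = p) (v : E) :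
    fderiv ℝ Ψ (u₀, p₀) (0, v) = v := by
  have h1 : HasFDerivAt (fun p : E => Ψ (u₀, p))
      ((fderiv ℝ Ψ (u₀, p₀)).comp (ContinuousLinearMap.inr ℝ F E)) p₀ :=
    hΨ.hasFDerivAt.comp p₀ (hasFDerivAt_prodMk_right u₀ p₀)
  have h2 : HasFDerivAt (fun p : E => Ψ (u₀, p)) (ContinuousLinearMap.id ℝ E) p₀ :=
    (hasFDerivAt_id p₀).congr_of_eventuallyEq hid
  simpa using congrArg (fun D : E →L[ℝ] E => D v) (h1.unique h2)

/-- The derivative in `u` of the pull-back under `Ψ (u, ·)` of a field `G` of bilinear forms, at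
the parameter where `Ψ (u, ·)` is the identity: this is the Lie derivative of `G` along the
infinitesimal action of `ξ`. -/
theorem hasFDerivAt_pullback_bilinear {Ψ : F × E → E} {u₀ : F} {p₀ : E}
    (hΨ : ContDiffAt ℝ 2 Ψ (u₀, p₀)) (hid : ∀ᶠ p in 𝓝 p₀, Ψ (u₀, p) = p)
    {G : E → E →L[ℝ] E →L[ℝ] ℝ} (hG : DifferentiableAt ℝ G p₀) (v w : E) :
    ∃ L : F →L[ℝ] ℝ, HasFDerivAt (fun u => G (Ψ (u, p₀)) (fderiv ℝ Ψ (u, p₀) (0, v))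
      (fderiv ℝ Ψ (u, p₀) (0, w))) L u₀ ∧
      ∀ ξ, L ξ = fderiv ℝ G p₀ (fderiv ℝ Ψ (u₀, p₀) (ξ, 0)) v w
        + G p₀ (linearizedAction Ψ (u₀, p₀) ξ v) w
        + G p₀ v (linearizedAction Ψ (u₀, p₀) ξ w) := by
  have hd : DifferentiableAt ℝ Ψ (u₀, p₀) := hΨ.differentiableAt (by norm_num)
  have h0 : Ψ (u₀, p₀) = p₀ := hid.self_of_nhds
  have h1 : HasFDerivAt (fun u : F => Ψ (u, p₀))
      ((fderiv ℝ Ψ (u₀, p₀)).comp (ContinuousLinearMap.inl ℝ F E)) u₀ :=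
    hd.hasFDerivAt.comp u₀ (hasFDerivAt_prodMk_left u₀ p₀)
  have h2 : HasFDerivAt (fun u : F => G (Ψ (u, p₀))) ((fderiv ℝ G p₀).comp
      ((fderiv ℝ Ψ (u₀, p₀)).comp (ContinuousLinearMap.inl ℝ F E))) u₀ := by
    refine HasFDerivAt.comp u₀ (g := G) ?_ h1
    rw [h0]
    exact hG.hasFDerivAt
  have h3 := (h2.clm_apply (hasFDerivAt_fderiv_apply_left hΨ v)).clm_apply
    (hasFDerivAt_fderiv_apply_left hΨ w)
  refine ⟨_, h3, fun ξ => ?_⟩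
  simp [h0, fderiv_inr_of_eventually_eq hd hid, linearizedAction_apply]
  ring

/-- Cartan's formula in coordinates: if `W` is a closed `2`-form and the contraction of `W` with
the vector field `X` is the differential of a function `f`, then the Lie derivative of `W` along
`X` vanishes. Here `A` is the derivative of `X`, and the symmetry of the Hessian of `f` is `d (df)
= 0`. -/
theorem lieDerivative_eq_zero {W : E → E →L[ℝ] E →L[ℝ] ℝ} {p₀ : E} (hW : DifferentiableAt ℝ W p₀)
    (halt : ∀ᶠ p in 𝓝 p₀, ∀ v w, W p v w = -W p w v)
    (hclosed : ∀ u v w, fderiv ℝ W p₀ u v w - fderiv ℝ W p₀ v u w + fderiv ℝ W p₀ w u v = 0)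
    {f : E → ℝ} (hf : ContDiffAt ℝ 2 f p₀) {X : E → E} {A : E →L[ℝ] E} (hX : HasFDerivAt X A p₀)
    (hfX : ∀ᶠ p in 𝓝 p₀, ∀ v, fderiv ℝ f p v = W p v (X p)) :
    ∀ v w, fderiv ℝ W p₀ (X p₀) v w + W p₀ (A v) w + W p₀ v (A w) = 0 := by
  have hDf : DifferentiableAt ℝ (fderiv ℝ f) p₀ :=
    (hf.fderiv_right (m := 1) (by norm_num)).differentiableAt (by norm_num)
  have hWapp : ∀ v w, HasFDerivAt (fun p => W p v w) (((fderiv ℝ W p₀).flip v).flip w) p₀ := by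
    intro v w
    refine ((hW.hasFDerivAt.clm_apply (hasFDerivAt_const v p₀)).clm_apply
      (hasFDerivAt_const w p₀)).congr_fderiv ?_
    ext a
    simp
  have hDalt : ∀ u v w, fderiv ℝ W p₀ u v w = -fderiv ℝ W p₀ u w v := by
    intro u v w
    have h1 : (fun p => W p v w) =ᶠ[𝓝 p₀] fun p => -W p w v := by
      filter_upwards [halt] with p hp using hp v w
    have h2 := (hWapp v w).unique ((hWapp w v).neg.congr_of_eventuallyEq h1)
    simpa using congrArg (fun D : E →L[ℝ] ℝ => D u) h2
  have h1 : ∀ v w, fderiv ℝ (fderiv ℝ f) p₀ w v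
      = fderiv ℝ W p₀ w v (X p₀) + W p₀ v (A w) := by
    intro v w
    have h2 : HasFDerivAt (fun p => fderiv ℝ f p v) ((fderiv ℝ (fderiv ℝ f) p₀).flip v) p₀ := by
      refine (hDf.hasFDerivAt.clm_apply (hasFDerivAt_const v p₀)).congr_fderiv ?_
      ext a
      simp
    have h3 := (hW.hasFDerivAt.clm_apply (hasFDerivAt_const v p₀)).clm_apply hX
    have h4 : (fun p => fderiv ℝ f p v) =ᶠ[𝓝 p₀] fun p => W p v (X p) := by
      filter_upwards [hfX] with p hp using hp v
    have h5 := congrArg (fun D : E →L[ℝ] ℝ => D w) (h2.unique (h3.congr_of_eventuallyEq h4))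
    simp at h5
    linarith
  intro v w
  have hs : fderiv ℝ (fderiv ℝ f) p₀ w v = fderiv ℝ (fderiv ℝ f) p₀ v w :=
    hf.isSymmSndFDerivAt (by simp) w v
  rw [h1, h1] at hs
  have h2 := hclosed (X p₀) v w
  have h3 := hDalt v (X p₀) w
  have h4 := hDalt w (X p₀) v
  have h5 := halt.self_of_nhds (A v) w
  linarith

/-- If the infinitesimal action of `β` vanishes at `p₀`, then its linearization preserves the
tangent space of the orbit of `p₀`. Invariantly, it sends the value at `p₀` of the fundamental
field of `ξ` to that of a bracket of `β` and `ξ`; here the product `m` is known only near `u₀`, in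
a chart, and the symmetry of the second derivative of the orbit map `ψ` takes the place of the
bracket: up to vectors tangent to the orbit, the linearization of `b` at the velocity of `a` is
`D²ψ (b, a)`, and `D²ψ (ξ, β)` is tangent to the orbit since the velocity of `β` is zero. -/
theorem linearizedAction_mem_range {Ψ : F × E → E} {m : F × F → F} {u₀ : F} {p₀ : E}
    (hΨ : ContDiffAt ℝ 2 Ψ (u₀, p₀)) (hm : ContDiffAt ℝ 2 m (u₀, u₀))
    (hm0 : ∀ᶠ w in 𝓝 u₀, m (u₀, w) = w) (hm1 : ∀ᶠ u in 𝓝 u₀, m (u, u₀) = u) (h0 : Ψ (u₀, p₀) = p₀)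
    (hmul : ∀ᶠ q in 𝓝 (u₀, u₀), Ψ (q.1, Ψ (q.2, p₀)) = Ψ (m q, p₀))
    {β : F} (hβ : fderiv ℝ Ψ (u₀, p₀) (β, 0) = 0) (ξ : F) :
    ∃ η : F, linearizedAction Ψ (u₀, p₀) β (fderiv ℝ Ψ (u₀, p₀) (ξ, 0))
      = fderiv ℝ Ψ (u₀, p₀) (η, 0) := by
  set ψ : F → E := fun u => Ψ (u, p₀) with hψdef
  have hψ : ContDiffAt ℝ 2 ψ u₀ := by
    have h1 : ContDiffAt ℝ 2 (fun u : F => (u, p₀)) u₀ := by fun_prop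
    exact ContDiffAt.comp u₀ (g := Ψ) hΨ h1
  have hψ' : ∀ a, fderiv ℝ ψ u₀ a = fderiv ℝ Ψ (u₀, p₀) (a, 0) := by
    intro a
    have h1 : HasFDerivAt ψ ((fderiv ℝ Ψ (u₀, p₀)).comp (ContinuousLinearMap.inl ℝ F E)) u₀ :=
      (hΨ.differentiableAt (by norm_num)).hasFDerivAt.comp u₀ (hasFDerivAt_prodMk_left u₀ p₀)
    rw [h1.fderiv]
    simp
  have hmu : m (u₀, u₀) = u₀ := hm0.self_of_nhds
  have hslice : Tendsto (fun u : F => (u, u₀)) (𝓝 u₀) (𝓝 (u₀, u₀)) :=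
    (Continuous.prodMk_left u₀).tendsto u₀
  have hslice' : Tendsto (fun u : F => (u, p₀)) (𝓝 u₀) (𝓝 (u₀, p₀)) :=
    (Continuous.prodMk_left p₀).tendsto u₀
  have hmslice : Tendsto (fun u : F => m (u, u₀)) (𝓝 u₀) (𝓝 u₀) := by
    have := hm.continuousAt.tendsto.comp hslice
    rwa [hmu] at this
  -- differentiate `Ψ (u, ψ w) = ψ (m (u, w))` in `w` at `w = u₀`
  have hfirst : ∀ a, ∀ᶠ u in 𝓝 u₀, fderiv ℝ Ψ (u, p₀) (0, fderiv ℝ ψ u₀ a)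
      = fderiv ℝ ψ (m (u, u₀)) (fderiv ℝ m (u, u₀) (0, a)) := by
    intro a
    have e1 := hslice.eventually hmul.eventually_nhds
    have e2 := hslice.eventually (hm.eventually (by simp))
    have e3 := hslice'.eventually (hΨ.eventually (by simp))
    have e4 := hmslice.eventually (hψ.eventually (by simp))
    filter_upwards [e1, e2, e3, e4] with u h1 h2 h3 h4
    have k1 : HasFDerivAt (fun w => Ψ (u, ψ w)) ((fderiv ℝ Ψ (u, p₀)).comp
        ((ContinuousLinearMap.inr ℝ F E).comp (fderiv ℝ ψ u₀))) u₀ := by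
      have k3 : HasFDerivAt (fun w => (u, ψ w))
          ((ContinuousLinearMap.inr ℝ F E).comp (fderiv ℝ ψ u₀)) u₀ :=
        (hasFDerivAt_prodMk_right u (ψ u₀)).comp u₀
          (hψ.differentiableAt (by norm_num)).hasFDerivAt
      refine HasFDerivAt.comp u₀ (g := Ψ) ?_ k3
      have : ψ u₀ = p₀ := h0
      rw [this]
      exact (h3.differentiableAt (by norm_num)).hasFDerivAt
    have k2 : HasFDerivAt (fun w => ψ (m (u, w))) ((fderiv ℝ ψ (m (u, u₀))).comp
        ((fderiv ℝ m (u, u₀)).comp (ContinuousLinearMap.inr ℝ F F))) u₀ := by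
      refine HasFDerivAt.comp u₀ (g := ψ) (h4.differentiableAt (by norm_num)).hasFDerivAt ?_
      exact (h2.differentiableAt (by norm_num)).hasFDerivAt.comp u₀ (hasFDerivAt_prodMk_right u u₀)
    have h5 : (fun w => Ψ (u, ψ w)) =ᶠ[𝓝 u₀] fun w => ψ (m (u, w)) :=
      ((Continuous.prodMk_right u).tendsto u₀).eventually h1
    have h6 := congrArg (fun D : F →L[ℝ] E => D a) (k1.unique (k2.congr_of_eventuallyEq h5))
    simpa using h6
  -- differentiate the result in `u` at `u = u₀`
  have hsecond : ∀ b a, ∃ η, linearizedAction Ψ (u₀, p₀) b (fderiv ℝ ψ u₀ a)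
      = fderiv ℝ (fderiv ℝ ψ) u₀ b a + fderiv ℝ ψ u₀ η := by
    intro b a
    have k1 := hasFDerivAt_fderiv_apply_left hΨ (fderiv ℝ ψ u₀ a)
    have hDψ : DifferentiableAt ℝ (fderiv ℝ ψ) u₀ :=
      (hψ.fderiv_right (m := 1) (by norm_num)).differentiableAt (by norm_num)
    have k2 := hDψ.hasFDerivAt.clm_apply (hasFDerivAt_fderiv_apply_left hm a)
    have h5 : (fun u => fderiv ℝ Ψ (u, p₀) (0, fderiv ℝ ψ u₀ a)) =ᶠ[𝓝 u₀]
        fun u => fderiv ℝ ψ u (fderiv ℝ m (u, u₀) (0, a)) := by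
      filter_upwards [hfirst a, hm1] with u hu hu'
      rw [hu, hu']
    have h6 := congrArg (fun D : F →L[ℝ] E => D b) (k1.unique (k2.congr_of_eventuallyEq h5))
    refine ⟨fderiv ℝ (fderiv ℝ m) (u₀, u₀) (b, 0) (0, a), ?_⟩
    simp [fderiv_inr_of_eventually_eq (hm.differentiableAt (by norm_num)) hm0] at h6
    rw [linearizedAction_apply, h6, add_comm]
  have hβ' : fderiv ℝ ψ u₀ β = 0 := by rw [hψ', hβ]
  obtain ⟨η₁, h1⟩ := hsecond β ξ
  obtain ⟨η₂, h2⟩ := hsecond ξ β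
  have hs : fderiv ℝ (fderiv ℝ ψ) u₀ β ξ = fderiv ℝ (fderiv ℝ ψ) u₀ ξ β :=
    hψ.isSymmSndFDerivAt (by simp) β ξ
  rw [hβ', map_zero] at h2
  refine ⟨η₁ - η₂, ?_⟩
  rw [← hψ', ← hψ', h1, hs, map_sub, eq_neg_of_add_eq_zero_left h2.symm]
  abel
end

/-! ### The metric in a chart -/

section
variable {E : Type*} [NormedAddCommGroup E] [NormedSpace ℂ E]

/-- The derivative of a map of real manifolds, as a linear map between the model spaces. It is
`mfderiv`, with the tangent spaces unfolded to the model spaces, so that vectors at different points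
can be compared and multiplied by `i`. -/
noncomputable def modelDeriv {V W : Type*} [NormedAddCommGroup V] [NormedSpace ℝ V]
    [NormedAddCommGroup W] [NormedSpace ℝ W] {M M' : Type*} [TopologicalSpace M]
    [ChartedSpace V M] [TopologicalSpace M'] [ChartedSpace W M'] (f : M → M') (x : M) : V →L[ℝ] W :=
  mfderiv 𝓘(ℝ, V) 𝓘(ℝ, W) f x

section
variable {V V' V'' : Type*} [NormedAddCommGroup V] [NormedSpace ℝ V]
  [NormedAddCommGroup V'] [NormedSpace ℝ V'] [NormedAddCommGroup V''] [NormedSpace ℝ V'']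
  {M M' M'' : Type*} [TopologicalSpace M] [ChartedSpace V M] [TopologicalSpace M']
  [ChartedSpace V' M'] [TopologicalSpace M''] [ChartedSpace V'' M'']

theorem modelDeriv_comp {f : M' → M''} {h : M → M'} (x : M)
    (hf : MDifferentiableAt 𝓘(ℝ, V') 𝓘(ℝ, V'') f (h x))
    (hh : MDifferentiableAt 𝓘(ℝ, V) 𝓘(ℝ, V') h x) :
    modelDeriv (V := V) (W := V'') (fun y => f (h y)) x
      = (modelDeriv (V := V') (W := V'') f (h x)).comp (modelDeriv (V := V) (W := V') h x) :=
  mfderiv_comp x hf hh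

theorem modelDeriv_eq_fderiv (f : V → V') (x : V) : modelDeriv f x = fderiv ℝ f x :=
  mfderiv_eq_fderiv

end

/-- The real derivative of a holomorphic map of complex manifolds is complex linear. -/
theorem modelDeriv_smul_I {E' : Type*} [NormedAddCommGroup E'] [NormedSpace ℂ E']
    {M M' : Type*} [TopologicalSpace M] [ChartedSpace E M]
    [TopologicalSpace M'] [ChartedSpace E' M'] {f : M → M'} {x : M}
    (hf : MDifferentiableAt 𝓘(ℂ, E) 𝓘(ℂ, E') f x) (v : E) :
    modelDeriv f x (Complex.I • v) = Complex.I • (modelDeriv f x v : E') := by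
  have hd : DifferentiableWithinAt ℂ (writtenInExtChartAt 𝓘(ℂ, E) 𝓘(ℂ, E') x f)
      (Set.range 𝓘(ℂ, E)) (extChartAt 𝓘(ℂ, E) x x) := hf.differentiableWithinAt_writtenInExtChartAt
  have hfR : MDifferentiableAt 𝓘(ℝ, E) 𝓘(ℝ, E') f x := by
    rw [mdifferentiableAt_iff]
    exact ⟨hf.continuousAt, hd.restrictScalars ℝ⟩
  have h1 : modelDeriv f x = fderivWithin ℝ (writtenInExtChartAt 𝓘(ℂ, E) 𝓘(ℂ, E') x f)
      (Set.range 𝓘(ℂ, E)) (extChartAt 𝓘(ℂ, E) x x) := by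
    exact hfR.mfderiv
  have h2 : UniqueDiffWithinAt ℝ (Set.range 𝓘(ℂ, E)) (extChartAt 𝓘(ℂ, E) x x) := by
    simp [uniqueDiffWithinAt_univ]
  rw [h1, ← hd.restrictScalars_fderivWithin ℝ h2]
  simp

variable {M : Type*} [TopologicalSpace M] [ChartedSpace E M]

theorem modelDeriv_extChartAt_symm_smul_I [IsManifold 𝓘(ℂ, E) ∞ M] {x : M} {p : E}
    (hp : p ∈ (extChartAt 𝓘(ℝ, E) x).target) (v : E) :
    modelDeriv (extChartAt 𝓘(ℝ, E) x).symm p (Complex.I • v)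
      = Complex.I • (modelDeriv (extChartAt 𝓘(ℝ, E) x).symm p v : E) := by
  refine modelDeriv_smul_I ?_ v
  have h2 : p ∈ (extChartAt 𝓘(ℂ, E) x).target := hp
  have := mdifferentiableWithinAt_extChartAt_symm (I := 𝓘(ℂ, E)) h2
  rwa [modelWithCornersSelf_coe, Set.range_id, mdifferentiableWithinAt_univ] at this

theorem modelDeriv_extChartAt_smul_I [IsManifold 𝓘(ℂ, E) ∞ M] {x y : M}
    (hy : y ∈ (extChartAt 𝓘(ℝ, E) x).source) (v : E) :
    modelDeriv (extChartAt 𝓘(ℝ, E) x) y (Complex.I • v)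
      = Complex.I • (modelDeriv (extChartAt 𝓘(ℝ, E) x) y v : E) :=
  modelDeriv_smul_I (mdifferentiableAt_extChartAt (I := 𝓘(ℂ, E)) (by simpa using hy)) v

section
variable {V : Type*} [NormedAddCommGroup V] [NormedSpace ℝ V]
  {N : Type*} [TopologicalSpace N] [ChartedSpace V N] [IsManifold 𝓘(ℝ, V) 1 N]

theorem mdifferentiableAt_extChartAt_symm_real {x : N} {p : V}
    (hp : p ∈ (extChartAt 𝓘(ℝ, V) x).target) :
    MDifferentiableAt 𝓘(ℝ, V) 𝓘(ℝ, V) (extChartAt 𝓘(ℝ, V) x).symm p := by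
  have := mdifferentiableWithinAt_extChartAt_symm hp
  rwa [modelWithCornersSelf_coe, Set.range_id, mdifferentiableWithinAt_univ] at this

theorem modelDeriv_extChartAt_modelDeriv_symm {x : N} {p : V}
    (hp : p ∈ (extChartAt 𝓘(ℝ, V) x).target) (v : V) :
    (modelDeriv (extChartAt 𝓘(ℝ, V) x) ((extChartAt 𝓘(ℝ, V) x).symm p)
      (modelDeriv (extChartAt 𝓘(ℝ, V) x).symm p v : V) : V) = v := by
  have h := mfderiv_extChartAt_comp_mfderivWithin_extChartAt_symm hp
  simp only [modelWithCornersSelf_coe, Set.range_id, mfderivWithin_univ] at h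
  exact congrArg (fun D : V →L[ℝ] V => D v) h

theorem modelDeriv_symm_modelDeriv_extChartAt {x y : N}
    (hy : y ∈ (extChartAt 𝓘(ℝ, V) x).source) (v : V) :
    (modelDeriv (extChartAt 𝓘(ℝ, V) x).symm (extChartAt 𝓘(ℝ, V) x y)
      (modelDeriv (extChartAt 𝓘(ℝ, V) x) y v : V) : V) = v := by
  have h := mfderivWithin_extChartAt_symm_comp_mfderiv_extChartAt' hy
  simp only [modelWithCornersSelf_coe, Set.range_id, mfderivWithin_univ] at h
  exact congrArg (fun D : V →L[ℝ] V => D v) h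

end

variable [IsManifold 𝓘(ℂ, E) ∞ M]

/-- The metric at a point, as a bilinear form on the model space: the tangent space at `x` is
identified with `E` by the preferred chart at `x`. -/
def HermitianMetric.modelInner (g : HermitianMetric E M) (x : M) : E →L[ℝ] E →L[ℝ] ℝ :=
  g.inner x

theorem HermitianMetric.modelInner_I (g : HermitianMetric E M) (x : M) (v w : E) :
    g.modelInner x (Complex.I • v) (Complex.I • w) = g.modelInner x v w :=
  g.inner_complexStructure x v w

theorem HermitianMetric.modelInner_symm (g : HermitianMetric E M) (x : M) (v w : E) :
    g.modelInner x v w = g.modelInner x w v :=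
  g.symm x v w

theorem HermitianMetric.modelInner_pos (g : HermitianMetric E M) (x : M) {v : E} (hv : v ≠ 0) :
    0 < g.modelInner x v v :=
  g.pos x v hv

/-- The metric read in the preferred chart `φ` at `x`, that is, its pull-back under `φ⁻¹`;
meaningful at the points `p` of the target of `φ`. -/
noncomputable def HermitianMetric.metricInChart (g : HermitianMetric E M) (x : M) (p : E) :
    E →L[ℝ] E →L[ℝ] ℝ :=
  (g.modelInner ((extChartAt 𝓘(ℝ, E) x).symm p)).bilinearComp
    (modelDeriv (extChartAt 𝓘(ℝ, E) x).symm p) (modelDeriv (extChartAt 𝓘(ℝ, E) x).symm p)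

theorem HermitianMetric.metricInChart_apply (g : HermitianMetric E M) (x : M) (p v w : E) :
    g.metricInChart x p v w = g.modelInner ((extChartAt 𝓘(ℝ, E) x).symm p)
      (modelDeriv (extChartAt 𝓘(ℝ, E) x).symm p v)
      (modelDeriv (extChartAt 𝓘(ℝ, E) x).symm p w) := rfl

theorem HermitianMetric.metricInChart_symm (g : HermitianMetric E M) (x : M) (p v w : E) :
    g.metricInChart x p v w = g.metricInChart x p w v := g.modelInner_symm _ _ _

theorem HermitianMetric.metricInChart_pos (g : HermitianMetric E M) {x : M} {p : E}
    (hp : p ∈ (extChartAt 𝓘(ℝ, E) x).target) {v : E} (hv : v ≠ 0) :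
    0 < g.metricInChart x p v v := by
  refine g.modelInner_pos _ fun h => hv ?_
  have h' : modelDeriv (W := E) (extChartAt 𝓘(ℝ, E) x).symm p v = 0 := h
  rw [← modelDeriv_extChartAt_modelDeriv_symm hp v, h', map_zero]

theorem HermitianMetric.metricInChart_I (g : HermitianMetric E M) {x : M} {p : E}
    (hp : p ∈ (extChartAt 𝓘(ℝ, E) x).target) (v w : E) :
    g.metricInChart x p (Complex.I • v) (Complex.I • w) = g.metricInChart x p v w := by
  rw [metricInChart_apply, modelDeriv_extChartAt_symm_smul_I hp,
    modelDeriv_extChartAt_symm_smul_I hp, g.modelInner_I]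
  rfl

theorem HermitianMetric.metricInChart_I_right (g : HermitianMetric E M) {x : M} {p : E}
    (hp : p ∈ (extChartAt 𝓘(ℝ, E) x).target) (v w : E) :
    g.metricInChart x p v (Complex.I • w) = -g.metricInChart x p (Complex.I • v) w := by
  have h := g.metricInChart_I hp (Complex.I • v) w
  rw [smul_smul, Complex.I_mul_I, neg_one_smul, map_neg] at h
  rw [← h]
  simp

/-- The coefficients of the metric in a chart are differentiable. They are the values of the metric
on pairs of coordinate vector fields, which are smooth sections of the tangent bundle because they
are constant in its trivialization over the chart. -/
theorem HermitianMetric.differentiableAt_metricInChart [FiniteDimensional ℂ E]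
    (g : HermitianMetric E M) {x : M} {p : E} (hp : p ∈ (extChartAt 𝓘(ℝ, E) x).target) :
    DifferentiableAt ℝ (g.metricInChart x) p := by
  have hfin : FiniteDimensional ℝ E := FiniteDimensional.complexToReal E
  set φ := extChartAt 𝓘(ℝ, E) x with hφ
  have hy : φ.symm p ∈ φ.source := φ.map_target hp
  have hy' : φ.symm p ∈ (chartAt E x).source := by simpa [hφ] using hy
  have hnhds : φ.target ∈ 𝓝 p := (isOpen_extChartAt_target x).mem_nhds hp
  suffices h : ContDiffOn ℝ 1 (g.metricInChart x) φ.target from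
    (h.contDiffAt hnhds).differentiableAt (by norm_num)
  refine contDiffOn_clm_apply.2 fun v => contDiffOn_clm_apply.2 fun w => ?_
  have hsec : ∀ u : E, ContMDiffOn 𝓘(ℝ, E) (𝓘(ℝ, E).prod 𝓘(ℝ, E)) 1
      (fun y : M => Bundle.TotalSpace.mk' E (E := fun y : M => TangentSpace 𝓘(ℝ, E) y) y
        ((trivializationAt E (TangentSpace 𝓘(ℝ, E)) x).symmL ℝ y u)) φ.source := by
    intro u
    have he : (trivializationAt E (TangentSpace 𝓘(ℝ, E)) x).baseSet = φ.source := by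
      simp [hφ]
    rw [← he, Bundle.Trivialization.contMDiffOn_section_baseSet_iff]
    refine (contMDiffOn_const (c := u)).congr fun y hy => ?_
    rw [Bundle.Trivialization.symmL_apply _ hy, Bundle.Trivialization.apply_mk_symm _ hy]
  have hg : ContMDiff 𝓘(ℝ, E) (𝓘(ℝ, E).prod 𝓘(ℝ, E →L[ℝ] E →L[ℝ] ℝ)) 1
    (fun b : M ↦ Bundle.TotalSpace.mk' (E →L[ℝ] E →L[ℝ] ℝ)
      (E := fun b : M => TangentSpace 𝓘(ℝ, E) b →L[ℝ] TangentSpace 𝓘(ℝ, E) b →L[ℝ] ℝ)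
      b (g.inner b)) := (g.contMDiff.of_le (by norm_num))
  have h := ContMDiffOn.clm_bundle_apply₂ (F₁ := E) (F₂ := E) (F₃ := ℝ) (E₃ := Bundle.Trivial M ℝ)
    hg.contMDiffOn (hsec v) (hsec w)
  have h2 : ContMDiffOn 𝓘(ℝ, E) 𝓘(ℝ, ℝ) 1 (fun m => g.modelInner m
      (modelDeriv φ.symm (φ m) v) (modelDeriv φ.symm (φ m) w)) φ.source := by
    intro y hy
    refine (Bundle.contMDiffWithinAt_section.1 (h y hy)).congr_of_mem (fun m hm => ?_) hy
    have hm' : m ∈ (chartAt E x).source := by simpa [hφ] using hm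
    have h3 : ∀ u : E, (modelDeriv φ.symm (φ m) u : E)
        = (trivializationAt E (TangentSpace 𝓘(ℝ, E)) x).symmL ℝ m u := by
      intro u
      rw [TangentBundle.symmL_trivializationAt hm', modelWithCornersSelf_coe, Set.range_id,
        mfderivWithin_univ]
      rfl
    rw [h3, h3]
    rfl
  have h4 : ContMDiffOn 𝓘(ℝ, E) 𝓘(ℝ, E) 1 φ.symm φ.target := contMDiffOn_extChartAt_symm x
  have h5 := h2.comp h4 (fun q hq => φ.map_target hq)
  refine h5.contDiffOn.congr fun q hq => ?_
  simp only [Function.comp_apply, φ.right_inv hq]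
  rfl
end

/-! ### The fundamental form in a chart -/

section
variable {E : Type*} [NormedAddCommGroup E] [NormedSpace ℂ E]

/-- The skew-symmetric part `(b (v, w) - b (w, v)) / 2` of a bilinear form, as an alternating map.
-/
noncomputable def alternatePairing (b : E →L[ℝ] E →L[ℝ] ℝ) : E [⋀^Fin 2]→L[ℝ] ℝ where
  toFun a := (1 / 2 : ℝ) * (b (a 0) (a 1) - b (a 1) (a 0))
  map_update_add' a i u v := by
    fin_cases i <;> simp [Function.update] <;> ring
  map_update_smul' a i c u := by
    fin_cases i <;> simp [Function.update] <;> ring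
  map_eq_zero_of_eq' a i j hij hne := by
    have h : a 0 = a 1 := by
      fin_cases i <;> fin_cases j <;> first | exact absurd rfl hne | exact hij | exact hij.symm
    simp [h]
  cont := by fun_prop

theorem alternatePairing_apply (b : E →L[ℝ] E →L[ℝ] ℝ) (a : Fin 2 → E) :
    alternatePairing b a = (1 / 2 : ℝ) * (b (a 0) (a 1) - b (a 1) (a 0)) := rfl

theorem LinearMap.differentiable_of_finiteDimensional {V W : Type*} [NormedAddCommGroup V]
    [NormedSpace ℝ V] [FiniteDimensional ℝ V] [NormedAddCommGroup W] [NormedSpace ℝ W]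
    (T : V →ₗ[ℝ] W) : Differentiable ℝ T :=
  (LinearMap.toContinuousLinearMap T).differentiable

theorem differentiable_alternatePairing [FiniteDimensional ℂ E] :
    Differentiable ℝ (alternatePairing (E := E)) := by
  have hfin : FiniteDimensional ℝ E := FiniteDimensional.complexToReal E
  let T : (E →L[ℝ] E →L[ℝ] ℝ) →ₗ[ℝ] E [⋀^Fin 2]→L[ℝ] ℝ :=
    { toFun := alternatePairing
      map_add' := fun b b' => by
        ext a
        simp [alternatePairing_apply]
        ring
      map_smul' := fun c b => by
        ext a
        simp [alternatePairing_apply]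
        ring }
  exact LinearMap.differentiable_of_finiteDimensional (V := E →L[ℝ] E →L[ℝ] ℝ)
    (W := E [⋀^Fin 2]→L[ℝ] ℝ) T

variable {M : Type*} [TopologicalSpace M] [ChartedSpace E M] [IsManifold 𝓘(ℂ, E) ∞ M]

/-- The fundamental form `g (v, J w)` read in the preferred chart at `x`, as a bilinear form; on the
target of the chart it is `HermitianMetric.formInChart`. -/
noncomputable def HermitianMetric.kahlerPairing (g : HermitianMetric E M) (x : M) (p : E) :
    E →L[ℝ] E →L[ℝ] ℝ :=
  (g.metricInChart x p).bilinearComp (ContinuousLinearMap.id ℝ E)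
    (Complex.I • ContinuousLinearMap.id ℝ E)

theorem HermitianMetric.kahlerPairing_apply (g : HermitianMetric E M) (x : M) (p v w : E) :
    g.kahlerPairing x p v w = g.metricInChart x p v (Complex.I • w) := rfl

theorem HermitianMetric.kahlerPairing_skew (g : HermitianMetric E M) {x : M} {p : E}
    (hp : p ∈ (extChartAt 𝓘(ℝ, E) x).target) (v w : E) :
    g.kahlerPairing x p v w = -g.kahlerPairing x p w v := by
  rw [kahlerPairing_apply, kahlerPairing_apply, g.metricInChart_I_right hp, g.metricInChart_symm]

theorem HermitianMetric.formInChart_eq (g : HermitianMetric E M) {x : M} {p : E}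
    (hp : p ∈ (extChartAt 𝓘(ℝ, E) x).target) (a : Fin 2 → E) :
    g.formInChart x p a = g.kahlerPairing x p (a 0) (a 1) := by
  rw [kahlerPairing_apply, metricInChart_apply, modelDeriv_extChartAt_symm_smul_I hp]
  rfl

theorem HermitianMetric.differentiableAt_kahlerPairing [FiniteDimensional ℂ E]
    (g : HermitianMetric E M) {x : M} {p : E} (hp : p ∈ (extChartAt 𝓘(ℝ, E) x).target) :
    DifferentiableAt ℝ (g.kahlerPairing x) p := by
  have hfin : FiniteDimensional ℝ E := FiniteDimensional.complexToReal E
  let T : (E →L[ℝ] E →L[ℝ] ℝ) →ₗ[ℝ] (E →L[ℝ] E →L[ℝ] ℝ) :=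
    { toFun := fun b => b.bilinearComp (ContinuousLinearMap.id ℝ E)
        (Complex.I • ContinuousLinearMap.id ℝ E)
      map_add' := fun b b' => by ext; simp
      map_smul' := fun c b => by ext; simp }
  have hT : Differentiable ℝ T := LinearMap.differentiable_of_finiteDimensional
    (V := E →L[ℝ] E →L[ℝ] ℝ) (W := E →L[ℝ] E →L[ℝ] ℝ) T
  have h := g.differentiableAt_metricInChart hp
  exact DifferentiableAt.comp (𝕜 := ℝ) (g := T) p (hT _) h

theorem HermitianMetric.differentiableAt_formInChart [FiniteDimensional ℂ E]
    (g : HermitianMetric E M) {x : M} {p : E} (hp : p ∈ (extChartAt 𝓘(ℝ, E) x).target) :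
    DifferentiableAt ℝ (g.formInChart x) p := by
  have h := g.differentiableAt_kahlerPairing hp
  have h1 : DifferentiableAt ℝ (fun q => alternatePairing (g.kahlerPairing x q)) p :=
    DifferentiableAt.comp (g := alternatePairing) p (differentiable_alternatePairing _) h
  refine h1.congr_of_eventuallyEq ?_
  filter_upwards [(isOpen_extChartAt_target x).mem_nhds hp] with q hq
  ext a
  rw [g.formInChart_eq hq, alternatePairing_apply,
    g.kahlerPairing_skew hq (a 1)]
  ring

/-- The equation `dω = 0` in a chart, in terms of the derivatives of the coefficients of `ω`. -/
theorem KahlerMetric.fderiv_kahlerPairing_cyclic [FiniteDimensional ℂ E]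
    (g : KahlerMetric E M) {x : M} {p : E} (hp : p ∈ (extChartAt 𝓘(ℝ, E) x).target) (u v w : E) :
    fderiv ℝ (g.kahlerPairing x) p u v w - fderiv ℝ (g.kahlerPairing x) p v u w
      + fderiv ℝ (g.kahlerPairing x) p w u v = 0 := by
  have h := congrArg (fun o => o ![u, v, w]) (g.closed x p hp)
  simp only [extDeriv_apply (g.differentiableAt_formInChart hp)] at h
  have h1 : ∀ a : Fin 2 → E, fderiv ℝ (fun q => g.formInChart x q a) p
      = ((fderiv ℝ (g.kahlerPairing x) p).flip (a 0)).flip (a 1) := by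
    intro a
    have h2 : (fun q => g.formInChart x q a) =ᶠ[𝓝 p] fun q => g.kahlerPairing x q (a 0) (a 1) := by
      filter_upwards [(isOpen_extChartAt_target x).mem_nhds hp] with q hq
      exact g.formInChart_eq hq a
    rw [h2.fderiv_eq]
    have h3 := ((g.differentiableAt_kahlerPairing hp).hasFDerivAt.clm_apply
      (hasFDerivAt_const (a 0) p)).clm_apply (hasFDerivAt_const (a 1) p)
    rw [h3.fderiv]
    ext b
    simp
  simp only [h1] at h
  have h2 := (Fin.sum_univ_three _).symm.trans h
  have e1 : (1 : Fin 3).succAbove (0 : Fin 2) = 0 := rfl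
  have e2 : (1 : Fin 3).succAbove (1 : Fin 2) = 2 := rfl
  have e3 : (2 : Fin 3).succAbove (0 : Fin 2) = 0 := rfl
  have e4 : (2 : Fin 3).succAbove (1 : Fin 2) = 1 := rfl
  simp [Fin.removeNth, e1, e2, e3, e4] at h2
  linarith
end

/-! ### The action in charts -/

theorem mdifferentiableAt_smul_const {E : Type*} [NormedAddCommGroup E] [NormedSpace ℂ E]
    {M : Type*} [TopologicalSpace M] [ChartedSpace E M]
    {F : Type*} [NormedAddCommGroup F] [NormedSpace ℝ F]
    {K : Type*} [TopologicalSpace K] [ChartedSpace F K] [Group K]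
    [MulAction K M] [ContMDiffSMul 𝓘(ℝ, F) 𝓘(ℝ, E) ∞ K M] (k : K) (y : M) :
    MDifferentiableAt 𝓘(ℝ, F) 𝓘(ℝ, E) (fun h : K => h • y) k := by
  have h1 : ContMDiffAt 𝓘(ℝ, F) 𝓘(ℝ, E) ∞ (fun h : K => h • y) k :=
    contMDiffAt_id.smul contMDiffAt_const
  exact h1.mdifferentiableAt (by simp)

theorem contMDiff_const_smul_real {E : Type*} [NormedAddCommGroup E] [NormedSpace ℂ E]
    {M : Type*} [TopologicalSpace M] [ChartedSpace E M]
    (F : Type*) [NormedAddCommGroup F] [NormedSpace ℝ F]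
    {K : Type*} [TopologicalSpace K] [ChartedSpace F K] [Group K]
    [MulAction K M] [ContMDiffSMul 𝓘(ℝ, F) 𝓘(ℝ, E) ∞ K M] (k : K) :
    ContMDiff 𝓘(ℝ, E) 𝓘(ℝ, E) ∞ (fun z : M => k • z) :=
  (contMDiff_const (I' := 𝓘(ℝ, F)) (c := k)).smul contMDiff_id

theorem mdifferentiableAt_const_smul {E : Type*} [NormedAddCommGroup E] [NormedSpace ℂ E]
    {M : Type*} [TopologicalSpace M] [ChartedSpace E M]
    (F : Type*) [NormedAddCommGroup F] [NormedSpace ℝ F]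
    {K : Type*} [TopologicalSpace K] [ChartedSpace F K] [Group K]
    [MulAction K M] [ContMDiffSMul 𝓘(ℝ, F) 𝓘(ℝ, E) ∞ K M] (k : K) (y : M) :
    MDifferentiableAt 𝓘(ℝ, E) 𝓘(ℝ, E) (fun z : M => k • z) y :=
  (contMDiff_const_smul_real F k).contMDiffAt.mdifferentiableAt (by simp)

section
variable {E : Type*} [NormedAddCommGroup E] [NormedSpace ℂ E]
  {M : Type*} [TopologicalSpace M] [ChartedSpace E M] [IsManifold 𝓘(ℂ, E) ∞ M]
  {F : Type*} [NormedAddCommGroup F] [NormedSpace ℝ F]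
  {K : Type*} [TopologicalSpace K] [ChartedSpace F K] [Group K] [LieGroup 𝓘(ℝ, F) ∞ K]
  [MulAction K M] [ContMDiffSMul 𝓘(ℝ, F) 𝓘(ℝ, E) ∞ K M]

variable (F K) in
/-- The action map `(k, y) ↦ k • y` read in the preferred charts of `K` at `1` and of `M` at `x`;
meaningful at the pairs `(u, p)` of points of the two targets for which the image lies in the domain
of the chart at `x`. -/
noncomputable def actionInChart (x : M) (q : F × E) : E :=
  extChartAt 𝓘(ℝ, E) x
    ((extChartAt 𝓘(ℝ, F) (1 : K)).symm q.1 • (extChartAt 𝓘(ℝ, E) x).symm q.2)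

theorem isManifold_one_of_lieGroup : IsManifold 𝓘(ℝ, F) 1 K :=
  have := LieGroup.of_le (I := 𝓘(ℝ, F)) (G := K) (m := 1) (n := ∞) (by norm_num)
  inferInstance

theorem contDiffAt_actionInChart {x : M} {u : F} {p : E}
    (hu : u ∈ (extChartAt 𝓘(ℝ, F) (1 : K)).target) (hp : p ∈ (extChartAt 𝓘(ℝ, E) x).target)
    (hup : (extChartAt 𝓘(ℝ, F) (1 : K)).symm u • (extChartAt 𝓘(ℝ, E) x).symm p
      ∈ (extChartAt 𝓘(ℝ, E) x).source) :
    ContDiffAt ℝ ∞ (actionInChart F K x) (u, p) := by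
  rw [← contMDiffAt_iff_contDiffAt]
  have h1 : ContMDiffAt 𝓘(ℝ, F × E) 𝓘(ℝ, F) ∞
      (fun q : F × E => (extChartAt 𝓘(ℝ, F) (1 : K)).symm q.1) (u, p) := by
    have h3 : ContMDiffAt 𝓘(ℝ, F) 𝓘(ℝ, F) ∞ (extChartAt 𝓘(ℝ, F) (1 : K)).symm u :=
      (contMDiffOn_extChartAt_symm 1).contMDiffAt ((isOpen_extChartAt_target 1).mem_nhds hu)
    exact ContMDiffAt.comp (u, p) h3 contDiff_fst.contMDiff.contMDiffAt
  have h2 : ContMDiffAt 𝓘(ℝ, F × E) 𝓘(ℝ, E) ∞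
      (fun q : F × E => (extChartAt 𝓘(ℝ, E) x).symm q.2) (u, p) := by
    have h3 : ContMDiffAt 𝓘(ℝ, E) 𝓘(ℝ, E) ∞ (extChartAt 𝓘(ℝ, E) x).symm p :=
      (contMDiffOn_extChartAt_symm x).contMDiffAt ((isOpen_extChartAt_target x).mem_nhds hp)
    exact ContMDiffAt.comp (u, p) h3 contDiff_snd.contMDiff.contMDiffAt
  have h4 : ContMDiffAt 𝓘(ℝ, E) 𝓘(ℝ, E) ∞ (extChartAt 𝓘(ℝ, E) x)
      ((extChartAt 𝓘(ℝ, F) (1 : K)).symm u • (extChartAt 𝓘(ℝ, E) x).symm p) :=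
    contMDiffAt_extChartAt' (by simpa using hup)
  exact ContMDiffAt.comp (u, p) h4 (h1.smul h2)

theorem fderiv_actionInChart_left {x : M} {u : F} {p : E}
    (hu : u ∈ (extChartAt 𝓘(ℝ, F) (1 : K)).target) (hp : p ∈ (extChartAt 𝓘(ℝ, E) x).target)
    (hup : (extChartAt 𝓘(ℝ, F) (1 : K)).symm u • (extChartAt 𝓘(ℝ, E) x).symm p
      ∈ (extChartAt 𝓘(ℝ, E) x).source) (ξ : F) :
    fderiv ℝ (actionInChart F K x) (u, p) (ξ, 0)
      = modelDeriv (extChartAt 𝓘(ℝ, E) x)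
          ((extChartAt 𝓘(ℝ, F) (1 : K)).symm u • (extChartAt 𝓘(ℝ, E) x).symm p)
        (modelDeriv (W := E) (fun k : K => k • (extChartAt 𝓘(ℝ, E) x).symm p)
          ((extChartAt 𝓘(ℝ, F) (1 : K)).symm u)
          (modelDeriv (W := F) (extChartAt 𝓘(ℝ, F) (1 : K)).symm u ξ)) := by
  have hK := isManifold_one_of_lieGroup (F := F) (K := K)
  have h1 := (((contDiffAt_actionInChart hu hp hup).differentiableAt (by simp)).hasFDerivAt.comp
    (f := fun a => (a, p)) u (hasFDerivAt_prodMk_left u p)).fderiv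
  have h2 := mdifferentiableAt_extChartAt_symm_real hu
  have h3 := mdifferentiableAt_smul_const (F := F) (E := E) ((extChartAt 𝓘(ℝ, F) (1 : K)).symm u)
    ((extChartAt 𝓘(ℝ, E) x).symm p)
  have h4 : MDifferentiableAt 𝓘(ℝ, E) 𝓘(ℝ, E) (extChartAt 𝓘(ℝ, E) x)
      ((extChartAt 𝓘(ℝ, F) (1 : K)).symm u • (extChartAt 𝓘(ℝ, E) x).symm p) :=
    mdifferentiableAt_extChartAt (by simpa using hup)
  have h5 := modelDeriv_comp u h4 (h3.comp u h2)
  have h6 := modelDeriv_comp u h3 h2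
  have h7 := congrArg (fun D : F →L[ℝ] E => D ξ) h1
  simp only [ContinuousLinearMap.comp_apply, ContinuousLinearMap.inl_apply] at h7
  rw [← h7, ← modelDeriv_eq_fderiv]
  refine (congrArg (fun D : F →L[ℝ] E => D ξ) h5).trans ?_
  exact congrArg (fun D : F →L[ℝ] E => modelDeriv (W := E) (extChartAt 𝓘(ℝ, E) x)
    ((extChartAt 𝓘(ℝ, F) (1 : K)).symm u • (extChartAt 𝓘(ℝ, E) x).symm p) (D ξ)) h6

theorem fderiv_actionInChart_right {x : M} {u : F} {p : E}
    (hu : u ∈ (extChartAt 𝓘(ℝ, F) (1 : K)).target) (hp : p ∈ (extChartAt 𝓘(ℝ, E) x).target)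
    (hup : (extChartAt 𝓘(ℝ, F) (1 : K)).symm u • (extChartAt 𝓘(ℝ, E) x).symm p
      ∈ (extChartAt 𝓘(ℝ, E) x).source) (v : E) :
    fderiv ℝ (actionInChart F K x) (u, p) (0, v)
      = modelDeriv (extChartAt 𝓘(ℝ, E) x)
          ((extChartAt 𝓘(ℝ, F) (1 : K)).symm u • (extChartAt 𝓘(ℝ, E) x).symm p)
        (modelDeriv (W := E) (fun y : M => (extChartAt 𝓘(ℝ, F) (1 : K)).symm u • y)
          ((extChartAt 𝓘(ℝ, E) x).symm p)
          (modelDeriv (W := E) (extChartAt 𝓘(ℝ, E) x).symm p v)) := by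
  have h1 := (((contDiffAt_actionInChart hu hp hup).differentiableAt (by simp)).hasFDerivAt.comp p
    (hasFDerivAt_prodMk_right u p)).fderiv
  have h2 := mdifferentiableAt_extChartAt_symm_real hp
  have h3 := mdifferentiableAt_const_smul (E := E) F ((extChartAt 𝓘(ℝ, F) (1 : K)).symm u)
    ((extChartAt 𝓘(ℝ, E) x).symm p)
  have h4 : MDifferentiableAt 𝓘(ℝ, E) 𝓘(ℝ, E) (extChartAt 𝓘(ℝ, E) x)
      ((extChartAt 𝓘(ℝ, F) (1 : K)).symm u • (extChartAt 𝓘(ℝ, E) x).symm p) :=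
    mdifferentiableAt_extChartAt (by simpa using hup)
  have h5 := modelDeriv_comp p h4 (h3.comp p h2)
  have h6 := modelDeriv_comp p h3 h2
  have h7 := congrArg (fun D : E →L[ℝ] E => D v) h1
  simp only [ContinuousLinearMap.comp_apply, ContinuousLinearMap.inr_apply] at h7
  rw [← h7, ← modelDeriv_eq_fderiv]
  refine (congrArg (fun D : E →L[ℝ] E => D v) h5).trans ?_
  exact congrArg (fun D : E →L[ℝ] E => modelDeriv (W := E) (extChartAt 𝓘(ℝ, E) x)
    ((extChartAt 𝓘(ℝ, F) (1 : K)).symm u • (extChartAt 𝓘(ℝ, E) x).symm p) (D v)) h6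
end

/-! ### Moment map and metric under the action in charts -/

/-- A function on a manifold with vanishing derivative is locally constant. -/
theorem isLocallyConstant_of_hasMFDerivAt_zero {F : Type*} [NormedAddCommGroup F]
    [NormedSpace ℝ F] {K : Type*} [TopologicalSpace K] [ChartedSpace F K]
    [IsManifold 𝓘(ℝ, F) 1 K] {f : K → ℝ}
    (hf : ∀ k, HasMFDerivAt 𝓘(ℝ, F) 𝓘(ℝ, ℝ) f k (0 : F →L[ℝ] ℝ)) : IsLocallyConstant f := by
  rw [IsLocallyConstant.iff_eventually_eq]
  intro k
  set κ := extChartAt 𝓘(ℝ, F) k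
  have hopen : IsOpen κ.target := isOpen_extChartAt_target k
  have hmem : κ k ∈ κ.target := mem_extChartAt_target k
  obtain ⟨r, hr, hball⟩ := Metric.isOpen_iff.1 hopen _ hmem
  have hd : ∀ u ∈ κ.target, HasFDerivAt (fun u => f (κ.symm u)) (0 : F →L[ℝ] ℝ) u := by
    intro u hu
    have h1 := (hf (κ.symm u)).comp u (mdifferentiableAt_extChartAt_symm_real hu).hasMFDerivAt
    have h2 := hasMFDerivAt_iff_hasFDerivAt.1 h1
    exact h2.congr_fderiv (ContinuousLinearMap.zero_comp _)
  have hconst : ∀ u ∈ Metric.ball (κ k) r, f (κ.symm u) = f k := by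
    intro u hu
    have h1 := (convex_ball (κ k) r).isPreconnected
    have h2 := Metric.isOpen_ball.is_const_of_fderiv_eq_zero h1
      (f := fun u => f (κ.symm u)) (𝕜 := ℝ)
      (fun v hv => (hd v (hball hv)).differentiableAt.differentiableWithinAt)
      (fun v hv => (hd v (hball hv)).fderiv) hu (Metric.mem_ball_self hr)
    simpa [κ] using h2
  have hc : ContinuousAt κ k := continuousAt_extChartAt k
  filter_upwards [hc.preimage_mem_nhds (Metric.ball_mem_nhds _ hr),
    extChartAt_source_mem_nhds (I := 𝓘(ℝ, F)) k]
    with y hy hy'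
  rw [← hconst _ hy, κ.left_inv hy']

theorem modelDeriv_smul_mul {E : Type*} [NormedAddCommGroup E] [NormedSpace ℂ E]
    {M : Type*} [TopologicalSpace M] [ChartedSpace E M]
    (F : Type*) [NormedAddCommGroup F] [NormedSpace ℝ F]
    {K : Type*} [TopologicalSpace K] [ChartedSpace F K] [Group K]
    [MulAction K M] [ContMDiffSMul 𝓘(ℝ, F) 𝓘(ℝ, E) ∞ K M] (k h : K) (x : M) (v : E) :
    (modelDeriv (W := E) (fun y : M => (h * k) • y) x v : E)
      = modelDeriv (W := E) (fun y : M => h • y) (k • x)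
        (modelDeriv (W := E) (fun y : M => k • y) x v) := by
  have h1 := modelDeriv_comp x (mdifferentiableAt_const_smul (E := E) F h (k • x))
    (mdifferentiableAt_const_smul (E := E) F k x)
  simp only [mul_smul]
  exact congrArg (fun D : E →L[ℝ] E => D v) h1

section
variable {E : Type*} [NormedAddCommGroup E] [NormedSpace ℂ E]
  {M : Type*} [TopologicalSpace M] [ChartedSpace E M] [IsManifold 𝓘(ℂ, E) ∞ M]
  {F : Type*} [NormedAddCommGroup F] [NormedSpace ℝ F]
  {K : Type*} [TopologicalSpace K] [ChartedSpace F K] [Group K] [LieGroup 𝓘(ℝ, F) ∞ K]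
  [MulAction K M] [ContMDiffSMul 𝓘(ℝ, F) 𝓘(ℝ, E) ∞ K M]

theorem fderiv_actionInChart_one {x : M} {p : E} (hp : p ∈ (extChartAt 𝓘(ℝ, E) x).target) (ξ : F) :
    fderiv ℝ (actionInChart F K x) (extChartAt 𝓘(ℝ, F) (1 : K) 1, p) (ξ, 0)
      = modelDeriv (extChartAt 𝓘(ℝ, E) x) ((extChartAt 𝓘(ℝ, E) x).symm p)
        (modelDeriv (W := E) (fun k : K => k • (extChartAt 𝓘(ℝ, E) x).symm p) 1 ξ) := by
  have hK := isManifold_one_of_lieGroup (F := F) (K := K)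
  have hy := (extChartAt 𝓘(ℝ, E) x).map_target hp
  have h1 : (extChartAt 𝓘(ℝ, F) (1 : K)).symm (extChartAt 𝓘(ℝ, F) (1 : K) 1) = 1 :=
    extChartAt_to_inv 1
  rw [fderiv_actionInChart_left (mem_extChartAt_target 1) hp (by rw [h1, one_smul]; exact hy),
    h1, one_smul]
  have h2 : modelDeriv (extChartAt 𝓘(ℝ, F) (1 : K)).symm (extChartAt 𝓘(ℝ, F) (1 : K) 1)
      = ContinuousLinearMap.id ℝ F := by
    have h := mfderivWithin_range_extChartAt_symm (I := 𝓘(ℝ, F)) (x := (1 : K))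
    rw [modelWithCornersSelf_coe, Set.range_id, mfderivWithin_univ] at h
    exact h
  rw [h2]
  rfl

theorem actionInChart_one {x : M} {p : E} (hp : p ∈ (extChartAt 𝓘(ℝ, E) x).target) :
    actionInChart F K x (extChartAt 𝓘(ℝ, F) (1 : K) 1, p) = p := by
  rw [actionInChart, extChartAt_to_inv, one_smul, (extChartAt 𝓘(ℝ, E) x).right_inv hp]

theorem contDiffAt_actionInChart_one {x : M} {p : E} (hp : p ∈ (extChartAt 𝓘(ℝ, E) x).target) :
    ContDiffAt ℝ ∞ (actionInChart F K x) (extChartAt 𝓘(ℝ, F) (1 : K) 1, p) := by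
  refine contDiffAt_actionInChart (mem_extChartAt_target 1) hp ?_
  rw [extChartAt_to_inv, one_smul]
  exact (extChartAt 𝓘(ℝ, E) x).map_target hp

theorem eventually_actionInChart_mem {x : M} {p : E} (hp : p ∈ (extChartAt 𝓘(ℝ, E) x).target) :
    ∀ᶠ u in 𝓝 (extChartAt 𝓘(ℝ, F) (1 : K) 1), u ∈ (extChartAt 𝓘(ℝ, F) (1 : K)).target ∧
      (extChartAt 𝓘(ℝ, F) (1 : K)).symm u • (extChartAt 𝓘(ℝ, E) x).symm p
        ∈ (extChartAt 𝓘(ℝ, E) x).source := by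
  have h1 : ContinuousAt (fun k : K => k • (extChartAt 𝓘(ℝ, E) x).symm p) 1 :=
    (mdifferentiableAt_smul_const (F := F) (E := E) 1 _).continuousAt
  have h2 : ContinuousAt (extChartAt 𝓘(ℝ, F) (1 : K)).symm (extChartAt 𝓘(ℝ, F) (1 : K) 1) :=
    continuousAt_extChartAt_symm 1
  have h3 := ContinuousAt.comp_of_eq (g := fun k : K => k • (extChartAt 𝓘(ℝ, E) x).symm p) h1 h2
    (extChartAt_to_inv 1)
  have h4 : ∀ᶠ u in 𝓝 (extChartAt 𝓘(ℝ, F) (1 : K) 1), u ∈ (extChartAt 𝓘(ℝ, F) (1 : K)).target :=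
    (isOpen_extChartAt_target (1 : K)).mem_nhds (mem_extChartAt_target 1)
  refine h4.and (h3.preimage_mem_nhds ((isOpen_extChartAt_source x).mem_nhds ?_))
  simp only [Function.comp_apply, extChartAt_to_inv, one_smul]
  exact (extChartAt 𝓘(ℝ, E) x).map_target hp

variable {g : HermitianMetric E M}

theorem HermitianMetric.metricInChart_extChartAt (g : HermitianMetric E M) {x z : M}
    (hz : z ∈ (extChartAt 𝓘(ℝ, E) x).source) (v w : E) :
    g.metricInChart x (extChartAt 𝓘(ℝ, E) x z) (modelDeriv (extChartAt 𝓘(ℝ, E) x) z v)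
      (modelDeriv (extChartAt 𝓘(ℝ, E) x) z w) = g.modelInner z v w := by
  rw [g.metricInChart_apply, modelDeriv_symm_modelDeriv_extChartAt hz,
    modelDeriv_symm_modelDeriv_extChartAt hz, (extChartAt 𝓘(ℝ, E) x).left_inv hz]

theorem metricInChart_actionInChart (g : HermitianMetric E M) {x : M} {u : F} {p : E}
    (hu : u ∈ (extChartAt 𝓘(ℝ, F) (1 : K)).target) (hp : p ∈ (extChartAt 𝓘(ℝ, E) x).target)
    (hup : (extChartAt 𝓘(ℝ, F) (1 : K)).symm u • (extChartAt 𝓘(ℝ, E) x).symm p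
      ∈ (extChartAt 𝓘(ℝ, E) x).source) (v w : E) :
    g.metricInChart x (actionInChart F K x (u, p))
      (fderiv ℝ (actionInChart F K x) (u, p) (0, v)) (fderiv ℝ (actionInChart F K x) (u, p) (0, w))
      = g.modelInner ((extChartAt 𝓘(ℝ, F) (1 : K)).symm u • (extChartAt 𝓘(ℝ, E) x).symm p)
        (modelDeriv (W := E) (fun y : M => (extChartAt 𝓘(ℝ, F) (1 : K)).symm u • y)
          ((extChartAt 𝓘(ℝ, E) x).symm p) (modelDeriv (W := E) (extChartAt 𝓘(ℝ, E) x).symm p v))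
        (modelDeriv (W := E) (fun y : M => (extChartAt 𝓘(ℝ, F) (1 : K)).symm u • y)
          ((extChartAt 𝓘(ℝ, E) x).symm p)
          (modelDeriv (W := E) (extChartAt 𝓘(ℝ, E) x).symm p w)) := by
  rw [fderiv_actionInChart_right hu hp hup, fderiv_actionInChart_right hu hp hup]
  exact g.metricInChart_extChartAt hup _ _

theorem kahlerPairing_actionInChart (g : HermitianMetric E M) {x : M} {u : F} {p : E}
    (hu : u ∈ (extChartAt 𝓘(ℝ, F) (1 : K)).target) (hp : p ∈ (extChartAt 𝓘(ℝ, E) x).target)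
    (hup : (extChartAt 𝓘(ℝ, F) (1 : K)).symm u • (extChartAt 𝓘(ℝ, E) x).symm p
      ∈ (extChartAt 𝓘(ℝ, E) x).source) (v w : E) :
    g.kahlerPairing x (actionInChart F K x (u, p))
      (fderiv ℝ (actionInChart F K x) (u, p) (0, v)) (fderiv ℝ (actionInChart F K x) (u, p) (0, w))
      = g.modelInner ((extChartAt 𝓘(ℝ, F) (1 : K)).symm u • (extChartAt 𝓘(ℝ, E) x).symm p)
        (modelDeriv (W := E) (fun y : M => (extChartAt 𝓘(ℝ, F) (1 : K)).symm u • y)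
          ((extChartAt 𝓘(ℝ, E) x).symm p) (modelDeriv (W := E) (extChartAt 𝓘(ℝ, E) x).symm p v))
        (Complex.I • modelDeriv (W := E) (fun y : M => (extChartAt 𝓘(ℝ, F) (1 : K)).symm u • y)
          ((extChartAt 𝓘(ℝ, E) x).symm p)
          (modelDeriv (W := E) (extChartAt 𝓘(ℝ, E) x).symm p w)) := by
  rw [fderiv_actionInChart_right hu hp hup, fderiv_actionInChart_right hu hp hup,
    g.kahlerPairing_apply, ← modelDeriv_extChartAt_smul_I hup]
  exact g.metricInChart_extChartAt hup _ _

theorem modelInner_smul (hg : IsIsometricAction K g) (k : K) (y : M) (v w : E) :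
    g.modelInner (k • y) (modelDeriv (fun z : M => k • z) y v) (modelDeriv (fun z : M => k • z) y w)
      = g.modelInner y v w := hg k y v w

/-- The defining equation of the moment map, read in a chart. -/
theorem fderiv_momentMap {ν : M → Module.Dual ℝ (GroupLieAlgebra 𝓘(ℝ, F) K)}
    (hν : IsMomentMap F g ν) {x : M} {p : E} (hp : p ∈ (extChartAt 𝓘(ℝ, E) x).target)
    (ξ : F) (v : E) :
    fderiv ℝ (fun q => ν ((extChartAt 𝓘(ℝ, E) x).symm q) ξ) p v
      = g.kahlerPairing x p v (fderiv ℝ (actionInChart F K x)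
        (extChartAt 𝓘(ℝ, F) (1 : K) 1, p) (ξ, 0)) := by
  set φ := extChartAt 𝓘(ℝ, E) x
  have hd : MDifferentiableAt 𝓘(ℝ, E) 𝓘(ℝ, ℝ) (fun y : M => ν y ξ) (φ.symm p) :=
    (hν.smooth ξ).contMDiffAt.mdifferentiableAt (by simp)
  have h1 := modelDeriv_comp p hd (mdifferentiableAt_extChartAt_symm_real hp)
  rw [modelDeriv_eq_fderiv] at h1
  have h2 := hν.deriv ξ (φ.symm p) (modelDeriv φ.symm p v : E)
  have h3 : (modelDeriv (W := E) φ.symm p (fderiv ℝ (actionInChart F K x)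
        (extChartAt 𝓘(ℝ, F) (1 : K) 1, p) (ξ, 0)) : E)
      = modelDeriv (W := E) (fun k : K => k • φ.symm p) 1 ξ := by
    rw [fderiv_actionInChart_one hp]
    have := modelDeriv_symm_modelDeriv_extChartAt (φ.map_target hp)
      (modelDeriv (W := E) (fun k : K => k • φ.symm p) 1 ξ)
    rwa [φ.right_inv hp] at this
  rw [g.kahlerPairing_apply, g.metricInChart_apply, modelDeriv_extChartAt_symm_smul_I hp, h3]
  refine (congrArg (fun D : E →L[ℝ] ℝ => D v) h1).trans ?_
  exact h2

theorem contDiffAt_momentMap {ν : M → Module.Dual ℝ (GroupLieAlgebra 𝓘(ℝ, F) K)}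
    (hν : IsMomentMap F g ν) {x : M} {p : E} (hp : p ∈ (extChartAt 𝓘(ℝ, E) x).target) (ξ : F) :
    ContDiffAt ℝ ∞ (fun q => ν ((extChartAt 𝓘(ℝ, E) x).symm q) ξ) p := by
  have h1 : ContMDiffAt 𝓘(ℝ, E) 𝓘(ℝ, E) ∞ (extChartAt 𝓘(ℝ, E) x).symm p :=
    (contMDiffOn_extChartAt_symm x).contMDiffAt ((isOpen_extChartAt_target x).mem_nhds hp)
  exact ((hν.smooth ξ).contMDiffAt.comp p h1).contDiffAt

theorem eventually_mem_extChartAt_target {x : M} {p : E}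
    (hp : p ∈ (extChartAt 𝓘(ℝ, E) x).target) : ∀ᶠ q in 𝓝 p, q ∈ (extChartAt 𝓘(ℝ, E) x).target :=
  (isOpen_extChartAt_target x).mem_nhds hp

/-! ### The action is holomorphic -/

/-- At `k = 1`, the pull-back of the fundamental form `ω` under the action of `k` is stationary in
`k`: the Lie derivative of `ω` along the fundamental fields vanishes. -/
theorem hasMFDerivAt_form_smul_one [FiniteDimensional ℂ E] (g : KahlerMetric E M)
    {ν : M → Module.Dual ℝ (GroupLieAlgebra 𝓘(ℝ, F) K)}
    (hν : IsMomentMap F g.toHermitianMetric ν) (x : M) (v w : E) :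
    HasMFDerivAt 𝓘(ℝ, F) 𝓘(ℝ, ℝ) (fun k : K => g.modelInner (k • x)
      (modelDeriv (W := E) (fun y : M => k • y) x v)
      (Complex.I • modelDeriv (W := E) (fun y : M => k • y) x w)) 1 (0 : F →L[ℝ] ℝ) := by
  have hK := isManifold_one_of_lieGroup (F := F) (K := K)
  set φ := extChartAt 𝓘(ℝ, E) x with hφ
  set κ := extChartAt 𝓘(ℝ, F) (1 : K) with hκ
  have hp : φ x ∈ φ.target := mem_extChartAt_target x
  have hx : φ.symm (φ x) = x := extChartAt_to_inv x
  have hid : ∀ᶠ p in 𝓝 (φ x), actionInChart F K x (κ 1, p) = p := by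
    filter_upwards [eventually_mem_extChartAt_target hp] with p hp' using actionInChart_one hp'
  have hΨ : ContDiffAt ℝ 2 (actionInChart F K x) (κ 1, φ x) :=
    (contDiffAt_actionInChart_one hp).of_le two_le_infty
  obtain ⟨L, hL, hLξ⟩ := hasFDerivAt_pullback_bilinear hΨ hid
    (g.differentiableAt_kahlerPairing hp) v w
  have hL0 : L = 0 := by
    ext ξ
    rw [hLξ]
    refine (lieDerivative_eq_zero (g.differentiableAt_kahlerPairing hp) ?_
      (g.fderiv_kahlerPairing_cyclic hp)
      ((contDiffAt_momentMap hν hp ξ).of_le two_le_infty)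
      (hasFDerivAt_fderiv_apply_right hΨ ξ) ?_) v w
    · filter_upwards [eventually_mem_extChartAt_target hp] with p hp' using g.kahlerPairing_skew hp'
    · filter_upwards [eventually_mem_extChartAt_target hp] with p hp' using
        fderiv_momentMap hν hp' ξ
  rw [hL0] at hL
  have hκd : HasMFDerivAt 𝓘(ℝ, F) 𝓘(ℝ, F) κ 1 (modelDeriv (W := F) κ 1 : F →L[ℝ] F) :=
    (mdifferentiableAt_extChartAt (mem_chart_source F (1 : K))).hasMFDerivAt
  have h1 := (hasMFDerivAt_iff_hasFDerivAt.2 hL).comp (1 : K) hκd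
  refine HasMFDerivAt.congr_of_eventuallyEq (h1.congr_mfderiv ?_) ?_
  · exact ContinuousLinearMap.zero_comp _
  · have hev : ContinuousAt κ 1 := continuousAt_extChartAt 1
    filter_upwards [hev.eventually (eventually_actionInChart_mem (F := F) (K := K) hp),
      extChartAt_source_mem_nhds (I := 𝓘(ℝ, F)) (1 : K)] with k hk hk'
    have h2 := kahlerPairing_actionInChart g.toHermitianMetric hk.1 hp hk.2 v w
    have h3 : ∀ a : E, (modelDeriv φ.symm (φ x) a : E) = a := by
      intro a
      have h := mfderivWithin_range_extChartAt_symm (I := 𝓘(ℝ, E)) (x := x)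
      rw [modelWithCornersSelf_coe, Set.range_id, mfderivWithin_univ] at h
      exact congrArg (fun D : E →L[ℝ] E => D a) h
    rw [h3, h3, hx, κ.left_inv hk'] at h2
    exact h2.symm

/-- The action of the connected group `K` preserves the fundamental form: by the group law, the
pull-back of `ω` under `k` is stationary at every `k`, hence constant. -/
theorem modelInner_smul_I [FiniteDimensional ℂ E] [ConnectedSpace K] (g : KahlerMetric E M)
    {ν : M → Module.Dual ℝ (GroupLieAlgebra 𝓘(ℝ, F) K)}
    (hν : IsMomentMap F g.toHermitianMetric ν) (x : M) (v w : E) (k : K) :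
    g.modelInner (k • x) (modelDeriv (W := E) (fun y : M => k • y) x v)
      (Complex.I • modelDeriv (W := E) (fun y : M => k • y) x w)
      = g.modelInner x v (Complex.I • w) := by
  have hK := isManifold_one_of_lieGroup (F := F) (K := K)
  -- write `k'` near `k` as `(k' k⁻¹) k`, to reduce to `hasMFDerivAt_form_smul_one` at `k • x`
  have hd : ∀ k : K, HasMFDerivAt 𝓘(ℝ, F) 𝓘(ℝ, ℝ) (fun k : K => g.modelInner (k • x)
      (modelDeriv (W := E) (fun y : M => k • y) x v)
      (Complex.I • modelDeriv (W := E) (fun y : M => k • y) x w)) k (0 : F →L[ℝ] ℝ) := by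
    intro k
    have h1 := hasMFDerivAt_form_smul_one g hν (k • x)
      (modelDeriv (W := E) (fun y : M => k • y) x v) (modelDeriv (W := E) (fun y : M => k • y) x w)
    have h2 : MDifferentiableAt 𝓘(ℝ, F) 𝓘(ℝ, F) (fun h : K => h * k⁻¹) k :=
      ((contMDiff_mul_right (I := 𝓘(ℝ, F)) (n := ∞) (a := k⁻¹)).contMDiffAt).mdifferentiableAt
        (by simp)
    have h3 := HasMFDerivAt.comp (I'' := 𝓘(ℝ, ℝ)) (I' := 𝓘(ℝ, F))
      (g := fun h : K => g.modelInner (h • k • x)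
      (modelDeriv (W := E) (fun y : M => h • y) (k • x)
        (modelDeriv (W := E) (fun y : M => k • y) x v))
      (Complex.I • modelDeriv (W := E) (fun y : M => h • y) (k • x)
        (modelDeriv (W := E) (fun y : M => k • y) x w))) k (g' := (0 : F →L[ℝ] ℝ)) ?_ h2.hasMFDerivAt
    · refine HasMFDerivAt.congr_of_eventuallyEq (h3.congr_mfderiv ?_)
        (Eventually.of_forall fun h => ?_)
      · exact ContinuousLinearMap.zero_comp _
      · simp only [Function.comp_apply]
        rw [← modelDeriv_smul_mul F, ← modelDeriv_smul_mul F, smul_smul,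
          inv_mul_cancel_right]
    · rw [mul_inv_cancel]
      exact h1
  have h1 := (isLocallyConstant_of_hasMFDerivAt_zero hd).apply_eq_of_preconnectedSpace k 1
  have h2 : ∀ a : E, (modelDeriv (W := E) (fun y : M => (1 : K) • y) x a : E) = a := by
    intro a
    simp only [one_smul]
    exact congrArg (fun D : E →L[ℝ] E => D a) (mfderiv_id (I := 𝓘(ℝ, E)) (x := x))
  rw [h1, h2, h2, one_smul]

/-- The action of `K` is by holomorphic maps, since it preserves both the metric and its fundamental
form, and the two determine the complex structure. -/
theorem modelDeriv_smul_complex [FiniteDimensional ℂ E] [ConnectedSpace K] (g : KahlerMetric E M)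
    (hg : IsIsometricAction K g.toHermitianMetric)
    {ν : M → Module.Dual ℝ (GroupLieAlgebra 𝓘(ℝ, F) K)}
    (hν : IsMomentMap F g.toHermitianMetric ν) (x : M) (w : E) (k : K) :
    (modelDeriv (fun y : M => k • y) x (Complex.I • w) : E)
      = Complex.I • modelDeriv (fun y : M => k • y) x w := by
  rw [← sub_eq_zero]
  by_contra hne
  set d := (modelDeriv (fun y : M => k • y) x (Complex.I • w) : E)
      - Complex.I • modelDeriv (fun y : M => k • y) x w with hd
  have h1 : ∀ v : E, g.modelInner (k • x) (modelDeriv (fun y : M => k • y) x v) d = 0 := by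
    intro v
    rw [hd, map_sub, modelInner_smul hg, modelInner_smul_I g hν, sub_self]
  have h2 : (modelDeriv (fun y : M => k • y) x
      (modelDeriv (W := E) (fun y : M => k⁻¹ • y) (k • x) d) : E) = d := by
    have h3 := modelDeriv_smul_mul F k⁻¹ k (k • x) d
    rw [inv_smul_smul] at h3
    rw [← h3, mul_inv_cancel]
    simp only [one_smul]
    exact congrArg (fun D : E →L[ℝ] E => D d) (mfderiv_id (I := 𝓘(ℝ, E)) (x := k • x))
  have h3 := h1 (modelDeriv (W := E) (fun y : M => k⁻¹ • y) (k • x) d)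
  rw [h2] at h3
  exact (g.modelInner_pos (k • x) hne).ne' h3

end

/-! ### The tangent space of the orbit at a maximum -/

section
variable {E : Type*} [NormedAddCommGroup E] [NormedSpace ℂ E]
  {M : Type*} [TopologicalSpace M] [ChartedSpace E M] [IsManifold 𝓘(ℂ, E) ∞ M]
  {F : Type*} [NormedAddCommGroup F] [NormedSpace ℝ F]
  {K : Type*} [TopologicalSpace K] [ChartedSpace F K] [Group K] [LieGroup 𝓘(ℝ, F) ∞ K]
  [MulAction K M] [ContMDiffSMul 𝓘(ℝ, F) 𝓘(ℝ, E) ∞ K M]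

variable (F K) in
/-- The product of `K` read in the preferred chart at `1`; meaningful near `(1, 1)`. -/
noncomputable def mulInChart (q : F × F) : F :=
  extChartAt 𝓘(ℝ, F) (1 : K)
    ((extChartAt 𝓘(ℝ, F) (1 : K)).symm q.1 * (extChartAt 𝓘(ℝ, F) (1 : K)).symm q.2)

theorem contDiffAt_mulInChart : ContDiffAt ℝ ∞ (mulInChart F K)
    (extChartAt 𝓘(ℝ, F) (1 : K) 1, extChartAt 𝓘(ℝ, F) (1 : K) 1) := by
  rw [← contMDiffAt_iff_contDiffAt]
  have h3 : ContMDiffAt 𝓘(ℝ, F) 𝓘(ℝ, F) ∞ (extChartAt 𝓘(ℝ, F) (1 : K)).symm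
      (extChartAt 𝓘(ℝ, F) (1 : K) 1) :=
    (contMDiffOn_extChartAt_symm 1).contMDiffAt
      ((isOpen_extChartAt_target (1 : K)).mem_nhds (mem_extChartAt_target 1))
  have h1 : ContMDiffAt 𝓘(ℝ, F × F) 𝓘(ℝ, F) ∞
      (fun q : F × F => (extChartAt 𝓘(ℝ, F) (1 : K)).symm q.1)
      (extChartAt 𝓘(ℝ, F) (1 : K) 1, extChartAt 𝓘(ℝ, F) (1 : K) 1) :=
    ContMDiffAt.comp (_, _) h3 contDiff_fst.contMDiff.contMDiffAt
  have h2 : ContMDiffAt 𝓘(ℝ, F × F) 𝓘(ℝ, F) ∞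
      (fun q : F × F => (extChartAt 𝓘(ℝ, F) (1 : K)).symm q.2)
      (extChartAt 𝓘(ℝ, F) (1 : K) 1, extChartAt 𝓘(ℝ, F) (1 : K) 1) :=
    ContMDiffAt.comp (_, _) h3 contDiff_snd.contMDiff.contMDiffAt
  have h4 := h1.mul h2
  refine ContMDiffAt.comp (g := extChartAt 𝓘(ℝ, F) (1 : K)) (_, _) ?_ h4
  simp only [extChartAt_to_inv, one_mul]
  exact contMDiffAt_extChartAt

theorem eventually_mulInChart : ∀ᶠ q in 𝓝 (extChartAt 𝓘(ℝ, F) (1 : K) 1,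
      extChartAt 𝓘(ℝ, F) (1 : K) 1),
    (extChartAt 𝓘(ℝ, F) (1 : K)).symm (mulInChart F K q)
      = (extChartAt 𝓘(ℝ, F) (1 : K)).symm q.1 * (extChartAt 𝓘(ℝ, F) (1 : K)).symm q.2 := by
  have htop : IsTopologicalGroup K := topologicalGroup_of_lieGroup 𝓘(ℝ, F) ∞
  have h3 : ContinuousAt (extChartAt 𝓘(ℝ, F) (1 : K)).symm (extChartAt 𝓘(ℝ, F) (1 : K) 1) :=
    continuousAt_extChartAt_symm 1
  have h1 : ContinuousAt (fun q : F × F => (extChartAt 𝓘(ℝ, F) (1 : K)).symm q.1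
      * (extChartAt 𝓘(ℝ, F) (1 : K)).symm q.2)
      (extChartAt 𝓘(ℝ, F) (1 : K) 1, extChartAt 𝓘(ℝ, F) (1 : K) 1) :=
    (ContinuousAt.comp (g := (extChartAt 𝓘(ℝ, F) (1 : K)).symm) (f := Prod.fst)
      (x := (extChartAt 𝓘(ℝ, F) (1 : K) 1, extChartAt 𝓘(ℝ, F) (1 : K) 1)) h3 continuousAt_fst).mul
      (ContinuousAt.comp (g := (extChartAt 𝓘(ℝ, F) (1 : K)).symm) (f := Prod.snd)
      (x := (extChartAt 𝓘(ℝ, F) (1 : K) 1, extChartAt 𝓘(ℝ, F) (1 : K) 1)) h3 continuousAt_snd)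
  have h2 : (extChartAt 𝓘(ℝ, F) (1 : K)).source ∈
      𝓝 ((extChartAt 𝓘(ℝ, F) (1 : K)).symm (extChartAt 𝓘(ℝ, F) (1 : K) 1)
      * (extChartAt 𝓘(ℝ, F) (1 : K)).symm (extChartAt 𝓘(ℝ, F) (1 : K) 1)) := by
    simp only [extChartAt_to_inv, one_mul]
    exact extChartAt_source_mem_nhds 1
  filter_upwards [h1.preimage_mem_nhds h2] with q hq
  exact (extChartAt 𝓘(ℝ, F) (1 : K)).left_inv hq

theorem eventually_mulInChart_one : (∀ᶠ u in 𝓝 (extChartAt 𝓘(ℝ, F) (1 : K) 1),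
      mulInChart F K (extChartAt 𝓘(ℝ, F) (1 : K) 1, u) = u) ∧
    ∀ᶠ u in 𝓝 (extChartAt 𝓘(ℝ, F) (1 : K) 1),
      mulInChart F K (u, extChartAt 𝓘(ℝ, F) (1 : K) 1) = u := by
  have h : ∀ᶠ u in 𝓝 (extChartAt 𝓘(ℝ, F) (1 : K) 1), u ∈ (extChartAt 𝓘(ℝ, F) (1 : K)).target :=
    (isOpen_extChartAt_target (1 : K)).mem_nhds (mem_extChartAt_target 1)
  constructor <;> filter_upwards [h] with u hu
  · rw [mulInChart, extChartAt_to_inv, one_mul, (extChartAt 𝓘(ℝ, F) (1 : K)).right_inv hu]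
  · rw [mulInChart, extChartAt_to_inv, mul_one, (extChartAt 𝓘(ℝ, F) (1 : K)).right_inv hu]

/-- The associativity `k • h • x = (k h) • x` of the action, in charts and near `(1, 1)`. -/
theorem actionInChart_mul (x : M) : ∀ᶠ q in 𝓝 (extChartAt 𝓘(ℝ, F) (1 : K) 1,
      extChartAt 𝓘(ℝ, F) (1 : K) 1),
    actionInChart F K x (q.1, actionInChart F K x (q.2, extChartAt 𝓘(ℝ, E) x x))
      = actionInChart F K x (mulInChart F K q, extChartAt 𝓘(ℝ, E) x x) := by
  have h1 := eventually_actionInChart_mem (F := F) (K := K) (mem_extChartAt_target (I := 𝓘(ℝ, E)) x)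
  filter_upwards [eventually_mulInChart (F := F) (K := K),
    (continuous_snd.tendsto (extChartAt 𝓘(ℝ, F) (1 : K) 1,
      extChartAt 𝓘(ℝ, F) (1 : K) 1)).eventually h1] with q hq hq'
  simp only [actionInChart]
  rw [hq, (extChartAt 𝓘(ℝ, E) x).left_inv hq'.2, smul_smul]

end

/-- If `‖c‖ ≤ ‖b‖`, then `⟨c - b, η⟩² ≤ 2 ‖η‖² (‖b‖² - ⟨c, b⟩)`: the Cauchy-Schwarz inequality, and
`‖c - b‖² ≤ 2 (‖b‖² - ⟨c, b⟩)`. -/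
theorem sq_apply_le_of_pos {V : Type*} [AddCommGroup V] [Module ℝ V] (B : LinearMap.BilinForm ℝ V)
    (hs : ∀ a b, B a b = B b a) (hp : ∀ a, a ≠ 0 → 0 < B a a) {b c : V} (hbc : B c c ≤ B b b)
    (η : V) : (B c η - B b η) ^ 2 ≤ 2 * B η η * (B b b - B c b) := by
  have hp' : ∀ a, 0 ≤ B a a := fun a => by
    rcases eq_or_ne a 0 with rfl | h
    · simp
    · exact (hp a h).le
  have h1 := LinearMap.BilinForm.apply_mul_apply_le_of_forall_zero_le B hp' (c - b) η
  rw [hs η] at h1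
  simp only [map_sub, LinearMap.sub_apply] at h1
  have h2 := hs b c
  nlinarith [hp' η]

section
variable {E : Type*} [NormedAddCommGroup E] [NormedSpace ℂ E] [FiniteDimensional ℂ E]
  {M : Type*} [TopologicalSpace M] [ChartedSpace E M] [IsManifold 𝓘(ℂ, E) ∞ M]
  {F : Type*} [NormedAddCommGroup F] [NormedSpace ℝ F]
  {K : Type*} [TopologicalSpace K] [ChartedSpace F K] [Group K] [LieGroup 𝓘(ℝ, F) ∞ K]
  [MulAction K M] [ContMDiffSMul 𝓘(ℝ, F) 𝓘(ℝ, E) ∞ K M]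

/-- If `‖μ‖²` is maximal at `x`, then the tangent space at `x` of the orbit of `x` is a complex
subspace. The proof applies `complex_invariant_of_form` to the linearization `A` at `x` of the
fundamental field of `β = μ x`. -/
theorem orbit_tangent_complex_of_isMax (g : HermitianMetric E M)
    (hg : IsIsometricAction K g)
    (B : LinearMap.BilinForm ℝ (GroupLieAlgebra 𝓘(ℝ, F) K))
    (hBs : ∀ a b, B a b = B b a) (hBp : ∀ a, a ≠ 0 → 0 < B a a)
    (μ : M → GroupLieAlgebra 𝓘(ℝ, F) K)
    (hμ : IsMomentMap F g (fun y : M => B (μ y)))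
    (x : M) (hx : ∀ y : M, B (μ y) (μ y) ≤ B (μ x) (μ x)) (ξ : F) :
    ∃ η : F, Complex.I • modelDeriv (W := E) (fun k : K => k • x) 1 ξ
      = modelDeriv (W := E) (fun k : K => k • x) 1 η := by
  have hfin : FiniteDimensional ℝ E := FiniteDimensional.complexToReal E
  set φ := extChartAt 𝓘(ℝ, E) x with hφ
  set κ := extChartAt 𝓘(ℝ, F) (1 : K) with hκ
  set p₀ := φ x with hp₀
  set Ψ := actionInChart (E := E) F K x with hΨdef
  set G := g.metricInChart x with hG
  have hp : p₀ ∈ φ.target := mem_extChartAt_target (I := 𝓘(ℝ, E)) x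
  have hφx : φ.symm p₀ = x := extChartAt_to_inv x
  let β : F := μ x
  -- the derivative at `1` of the orbit map, in charts; its range is the tangent space of the orbit
  have hD : ∀ a : F, modelDeriv (W := E) (fun k : K => k • x) 1 a
      = fderiv ℝ Ψ (κ 1, p₀) (a, 0) := by
    intro a
    rw [hΨdef, fderiv_actionInChart_one hp, ← hφ, hφx]
    exact (congrArg (fun D : E →L[ℝ] E => D _) (mfderiv_extChartAt_self (I := 𝓘(ℝ, E)))).symm
  have hid : ∀ᶠ p in 𝓝 p₀, Ψ (κ 1, p) = p := by
    filter_upwards [eventually_mem_extChartAt_target hp] with p hp' using actionInChart_one hp'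
  have hΨ : ContDiffAt ℝ 2 Ψ (κ 1, p₀) := (contDiffAt_actionInChart_one hp).of_le two_le_infty
  set A := linearizedAction Ψ (κ 1, p₀) β with hA
  -- `f η` is the component of the moment map along `η`
  let f : F → E → ℝ := fun η q => B (μ (φ.symm q)) η
  have hf : ∀ η, ContDiffAt ℝ 2 (f η) p₀ := fun η =>
    (contDiffAt_momentMap hμ hp η).of_le two_le_infty
  have hfd : ∀ η, ∀ᶠ q in 𝓝 p₀, ∀ v, fderiv ℝ (f η) q v
      = g.kahlerPairing x q v (fderiv ℝ Ψ (κ 1, q) (η, 0)) := by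
    intro η
    filter_upwards [eventually_mem_extChartAt_target hp] with q hq using fderiv_momentMap hμ hq η
  have hle : ∀ η q, (f η q - f η p₀) ^ 2 ≤ 2 * B η η * (f β p₀ - f β q) := by
    intro η q
    have := sq_apply_le_of_pos B hBs hBp (hx (φ.symm q)) η
    simpa only [f, hφx, β] using this
  have hGd : DifferentiableAt ℝ G p₀ := g.differentiableAt_metricInChart hp
  have hWd := g.differentiableAt_kahlerPairing hp
  have hGsymm : ∀ v w, G p₀ v w = G p₀ w v := g.metricInChart_symm x p₀
  have hGI : ∀ v w, G p₀ v (Complex.I • w) = -G p₀ (Complex.I • v) w :=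
    g.metricInChart_I_right hp
  have hGpos : ∀ v, v ≠ 0 → 0 < G p₀ v v := fun v hv => g.metricInChart_pos hp hv
  have hGnd : ∀ w, (∀ v, G p₀ v w = 0) → w = 0 := fun w hw => by
    by_contra hne
    exact (hGpos w hne).ne' (hw w)
  have hII : ∀ v : E, Complex.I • (Complex.I • v) = -v := fun v => by
    rw [smul_smul, Complex.I_mul_I, neg_one_smul]
  have hfd0 : ∀ η v, fderiv ℝ (f η) p₀ v = G p₀ v (Complex.I • fderiv ℝ Ψ (κ 1, p₀) (η, 0)) :=
    fun η => (hfd η).self_of_nhds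
  -- `f β` is maximal at `p₀`, hence the fundamental field of `β` has a zero there
  have hmax : ∀ q, f β q ≤ f β p₀ := by
    intro q
    have h1 := sq_apply_le_of_pos B hBs hBp (hx (φ.symm q)) β
    have h2 : 0 ≤ B (μ x - μ (φ.symm q)) (μ x - μ (φ.symm q)) := by
      rcases eq_or_ne (μ x - μ (φ.symm q)) 0 with h | h
      · rw [h]
        simp
      · exact (hBp _ h).le
    simp only [map_sub, LinearMap.sub_apply] at h2
    have h3 := hBs (μ x) (μ (φ.symm q))
    have h4 := hx (φ.symm q)
    simp only [f, hφx, β]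
    linarith
  have hβ : fderiv ℝ Ψ (κ 1, p₀) (β, 0) = 0 := by
    have h1 : fderiv ℝ (f β) p₀ = 0 :=
      IsLocalMax.fderiv_eq_zero (Eventually.of_forall hmax)
    have h2 : Complex.I • fderiv ℝ Ψ (κ 1, p₀) (β, 0) = 0 := by
      refine hGnd _ fun v => ?_
      rw [← hfd0, h1]
      rfl
    exact (smul_eq_zero.1 h2).resolve_left Complex.I_ne_zero
  -- the Hessian of `f β` is `g (v, J A w)`: the field of `β` vanishes at `p₀`, so the derivatives of
  -- the coefficients of the form do not contribute
  have hX := hasFDerivAt_fderiv_apply_right hΨ β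
  have hDf : DifferentiableAt ℝ (fderiv ℝ (f β)) p₀ :=
    ((hf β).fderiv_right (m := 1) (by norm_num)).differentiableAt (by norm_num)
  have hHess : ∀ v w, fderiv ℝ (fderiv ℝ (f β)) p₀ w v = G p₀ v (Complex.I • A w) := by
    intro v w
    have h2 := hDf.hasFDerivAt.clm_apply (hasFDerivAt_const v p₀)
    have h3 := (hWd.hasFDerivAt.clm_apply (hasFDerivAt_const v p₀)).clm_apply hX
    have h4 : (fun p => fderiv ℝ (f β) p v) =ᶠ[𝓝 p₀]
        fun p => g.kahlerPairing x p v (fderiv ℝ Ψ (κ 1, p) (β, 0)) := by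
      filter_upwards [hfd β] with p hp using hp v
    have h5 := congrArg (fun D : E →L[ℝ] ℝ => D w) (h2.unique (h3.congr_of_eventuallyEq h4))
    simp [hβ] at h5
    exact h5
  have hHsymm : ∀ v w, G p₀ v (Complex.I • A w) = G p₀ w (Complex.I • A v) := by
    intro v w
    rw [← hHess, ← hHess]
    exact (hf β).isSymmSndFDerivAt (by simp) w v
  have hHneg : ∀ v, G p₀ v (Complex.I • A v) ≤ 0 := by
    intro v
    have h1 := two_mul_sq_fderiv_le (h := fun _ => (0 : ℝ)) (C := 1) (hf β) contDiffAt_const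
      (Eventually.of_forall fun q => by have := hmax q; simp; linarith) v
    rw [hHess] at h1
    simpa using h1
  -- null vectors of the Hessian are killed by the differential of every component of the moment map
  have hHker : ∀ v η, G p₀ v (Complex.I • A v) = 0 →
      G p₀ v (Complex.I • fderiv ℝ Ψ (κ 1, p₀) (η, 0)) = 0 := by
    intro v η hv
    have h1 := two_mul_sq_fderiv_le (hf β) (hf η) (Eventually.of_forall (hle η)) v
    rw [hHess, hv, mul_zero, neg_zero, hfd0] at h1
    exact pow_eq_zero_iff (two_ne_zero) |>.1 (le_antisymm (by linarith) (sq_nonneg _))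
  -- `A` is skew, since the action preserves the metric
  have hAskew : ∀ v w, G p₀ (A v) w = -G p₀ v (A w) := by
    intro v w
    obtain ⟨L, hL, hLξ⟩ := hasFDerivAt_pullback_bilinear hΨ hid hGd v w
    have h1 : (fun u => G (Ψ (u, p₀)) (fderiv ℝ Ψ (u, p₀) (0, v)) (fderiv ℝ Ψ (u, p₀) (0, w)))
        =ᶠ[𝓝 (κ 1)] fun _ => G p₀ v w := by
      filter_upwards [eventually_actionInChart_mem (F := F) (K := K) hp] with u hu
      exact (metricInChart_actionInChart g hu.1 hp hu.2 v w).trans (modelInner_smul hg _ _ _ _)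
    have h2 : L = 0 := hL.unique ((hasFDerivAt_const _ _).congr_of_eventuallyEq h1)
    have h3 := hLξ β
    rw [h2, hβ] at h3
    simp at h3
    linarith
  -- the Hessian is symmetric and `A` is skew, hence `A` commutes with `J`
  have hAI : ∀ v, A (Complex.I • v) = Complex.I • A v := by
    intro v
    refine sub_eq_zero.1 (hGnd _ fun w => ?_)
    have h1 := hHsymm w v
    rw [hGI v, hGsymm _ (A w), hAskew, neg_neg] at h1
    rw [map_sub, h1, sub_self]
  -- the tangent space of the orbit
  let T : Submodule ℝ E := LinearMap.range
    ((fderiv ℝ Ψ (κ 1, p₀)).comp (ContinuousLinearMap.inl ℝ F E) : F →ₗ[ℝ] E)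
  have hmemT : ∀ v, v ∈ T ↔ ∃ η, fderiv ℝ Ψ (κ 1, p₀) (η, 0) = v := by
    intro v
    simp [T]
  have key := complex_invariant_of_form (V := E)
    ((ContinuousLinearMap.coeLM ℝ).comp (G p₀ : E →ₗ[ℝ] E →L[ℝ] ℝ)) hGsymm hGpos A
    (Complex.I • ContinuousLinearMap.id ℝ E : E →L[ℝ] E) T hAskew
    (fun v w => by have := hGI v w; simp; linarith) hII hAI ?_ hHneg ?_
  · have h1 := key _ ((hmemT _).2 ⟨ξ, rfl⟩)
    obtain ⟨η, hη⟩ := (hmemT _).1 h1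
    refine ⟨η, ?_⟩
    rw [hD, hD, hη]
    rfl
  · intro v hv
    obtain ⟨a, rfl⟩ := (hmemT _).1 hv
    obtain ⟨η, hη⟩ := linearizedAction_mem_range hΨ (contDiffAt_mulInChart.of_le two_le_infty)
      eventually_mulInChart_one.1 eventually_mulInChart_one.2 hid.self_of_nhds
      (actionInChart_mul x) hβ a
    exact (hmemT _).2 ⟨η, hη.symm⟩
  · intro v hv w hw
    obtain ⟨a, rfl⟩ := (hmemT _).1 hw
    -- `J v` is again a null vector, so `hHker` makes `J v` orthogonal to `J T`
    have h1 : G p₀ (Complex.I • v) (Complex.I • A (Complex.I • v)) = 0 := by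
      rw [hAI, hII, map_neg, ← hGI]
      exact hv
    have h2 := hHker _ a h1
    rw [hGI, hII] at h2
    simpa using h2

end

/-! ### Constant rank maps with complex tangent spaces -/

/-- A smooth map `ψ` of constant rank whose derivatives have complex subspaces as their images (`L`
at the point `u₀`) is, near `u₀`, a parametrization of a piece of complex submanifold: there is a
biholomorphic map `Θ` of open subsets of `E` carrying the image of a neighbourhood `U` of `u₀` onto
the trace of `L`. By the constant rank theorem, the image is the graph of a map `s` over an open
subset of `L`, with respect to a complex linear projection `π` onto `L`; the derivative of `s` is
complex linear because the tangent spaces of the image are complex, so `s` is holomorphic, and `Θ`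
is the shear `p ↦ p - s (π p) + π p`. -/
theorem exists_holomorphic_straightening {E : Type*} [NormedAddCommGroup E] [NormedSpace ℂ E]
    [FiniteDimensional ℂ E] {F : Type*} [NormedAddCommGroup F] [NormedSpace ℝ F]
    [FiniteDimensional ℝ F] {ψ : F → E} {u₀ : F} {N : Set F} (hN : IsOpen N) (hu₀ : u₀ ∈ N)
    (hψ : ContDiffOn ℝ ∞ ψ N) (L : Submodule ℂ E)
    (hL : ∀ v, v ∈ L ↔ ∃ a, fderiv ℝ ψ u₀ a = v)
    (hc : ∀ u ∈ N, ∀ a, ∃ b, Complex.I • fderiv ℝ ψ u a = fderiv ℝ ψ u b)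
    (hr : ∀ u ∈ N, Module.finrank ℝ (LinearMap.range (fderiv ℝ ψ u : F →ₗ[ℝ] E))
      = Module.finrank ℝ L) :
    ∃ (Θ : OpenPartialHomeomorph E E) (U : Set F), IsOpen U ∧ u₀ ∈ U ∧ U ⊆ N ∧
      ContDiffOn ℂ ∞ Θ Θ.source ∧ ContDiffOn ℂ ∞ Θ.symm Θ.target ∧ ψ '' U ⊆ Θ.source ∧
      Θ '' (ψ '' U) = Θ.target ∩ L := by
  have hfin : FiniteDimensional ℝ E := FiniteDimensional.complexToReal E
  obtain ⟨π₀, hπ₀⟩ := LinearMap.exists_leftInverse_of_injective L.subtype (by simp)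
  let π : E →L[ℂ] L := LinearMap.toContinuousLinearMap π₀
  have hπ : ∀ l : L, π (l : E) = l := fun l => congrArg (fun D : L →ₗ[ℂ] L => D l) hπ₀
  let πR : E →L[ℝ] L := π.restrictScalars ℝ
  have hψd : ∀ u ∈ N, HasFDerivAt ψ (fderiv ℝ ψ u) u := fun u hu =>
    ((hψ.contDiffAt (hN.mem_nhds hu)).differentiableAt (by simp)).hasFDerivAt
  let D₀ : F →L[ℝ] L := πR.comp (fderiv ℝ ψ u₀)
  obtain ⟨q₀, hq₀⟩ := LinearMap.exists_leftInverse_of_injective (D₀.ker).subtype (by simp)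
  let q : F →L[ℝ] D₀.ker := LinearMap.toContinuousLinearMap q₀
  have hq : ∀ a : D₀.ker, q (a : F) = a := fun a =>
    congrArg (fun D : D₀.ker →ₗ[ℝ] D₀.ker => D a) hq₀
  -- `Φ` is a local coordinate system at `u₀` whose first component is `π ∘ ψ`
  let Φ : F → L × D₀.ker := fun u => (πR (ψ u), q u)
  let Φ' : F → F →L[ℝ] L × D₀.ker := fun u => (πR.comp (fderiv ℝ ψ u)).prod q
  have hΦ : ContDiffOn ℝ ∞ Φ N := (πR.contDiff.comp_contDiffOn hψ).prodMk q.contDiff.contDiffOn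
  have hΦd : ∀ u ∈ N, HasFDerivAt Φ (Φ' u) u := fun u hu =>
    (πR.hasFDerivAt.comp u (hψd u hu)).prodMk q.hasFDerivAt
  -- the derivative at `u₀` is invertible
  have hbij : Function.Bijective (Φ' u₀) := by
    constructor
    · rw [injective_iff_map_eq_zero]
      intro a ha
      have h1 : D₀ a = 0 := congrArg Prod.fst ha
      have h2 : q a = 0 := congrArg Prod.snd ha
      have h3 := hq ⟨a, h1⟩
      rw [h2] at h3
      exact (congrArg Subtype.val h3).symm
    · rintro ⟨l, m⟩
      obtain ⟨a, ha⟩ := (hL l).1 l.2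
      have h1 : D₀ a = l := by
        change π (fderiv ℝ ψ u₀ a) = l
        rw [ha, hπ]
      refine ⟨a - (q a : F) + m, ?_⟩
      have h2 : D₀ (q a : F) = 0 := (q a).2
      have h3 : D₀ (m : F) = 0 := m.2
      refine Prod.ext ?_ ?_
      · change D₀ (a - (q a : F) + m) = l
        rw [map_add, map_sub, h1, h2, h3, sub_zero, add_zero]
      · change q (a - (q a : F) + m) = m
        rw [map_add, map_sub, hq, hq, sub_self, zero_add]
  let e₀ : F ≃L[ℝ] L × D₀.ker :=
    (LinearEquiv.ofBijective (Φ' u₀ : F →ₗ[ℝ] L × D₀.ker) hbij).toContinuousLinearEquiv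
  have he₀ : (e₀ : F →L[ℝ] L × D₀.ker) = Φ' u₀ := by
    ext a <;> rfl
  have hΦu₀ : ContDiffAt ℝ ∞ Φ u₀ := hΦ.contDiffAt (hN.mem_nhds hu₀)
  have hΦd₀ : HasFDerivAt Φ (e₀ : F →L[ℝ] L × D₀.ker) u₀ := by
    rw [he₀]
    exact hΦd u₀ hu₀
  let e := hΦu₀.toOpenPartialHomeomorph Φ hΦd₀ (by simp)
  have hu₀e : u₀ ∈ e.source := hΦu₀.mem_toOpenPartialHomeomorph_source hΦd₀ (by simp)
  -- a neighbourhood on which the derivative stays invertible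
  have hinv : ∀ᶠ u in 𝓝 u₀, ∃ e' : F ≃L[ℝ] L × D₀.ker, (e' : F →L[ℝ] L × D₀.ker) = Φ' u := by
    have h2 : ContinuousAt (fderiv ℝ Φ) u₀ := (hΦu₀.fderiv_right (m := 0) (by simp)).continuousAt
    have h3 := ContinuousLinearEquiv.nhds e₀
    rw [he₀, ← (hΦd u₀ hu₀).fderiv] at h3
    filter_upwards [h2.preimage_mem_nhds h3, hN.mem_nhds hu₀] with u hu hu'
    rw [← (hΦd u hu').fderiv]
    exact hu
  obtain ⟨W, hW, hWo, hu₀W⟩ := eventually_nhds_iff.1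
    (hinv.and ((hN.eventually_mem hu₀).and (e.open_source.eventually_mem hu₀e)))
  have hopen : IsOpen (e.target ∩ e.symm ⁻¹' W) :=
    e.symm.isOpen_inter_preimage hWo
  have hmem : Φ u₀ ∈ e.target ∩ e.symm ⁻¹' W := by
    refine ⟨e.map_source hu₀e, ?_⟩
    change e.symm (e u₀) ∈ W
    rwa [e.left_inv hu₀e]
  obtain ⟨r, hr0, hball⟩ := Metric.isOpen_iff.1 hopen _ hmem
  set z₀ : L := πR (ψ u₀) with hz₀
  set m₀ : D₀.ker := q u₀ with hm₀
  have hballmem : ∀ z ∈ Metric.ball z₀ r, ∀ m ∈ Metric.ball m₀ r,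
      (z, m) ∈ e.target ∧ e.symm (z, m) ∈ W := by
    intro z hz m hm
    refine hball ?_
    change (z, m) ∈ Metric.ball (z₀, m₀) r
    rw [← ball_prod_same]
    exact ⟨hz, hm⟩
  -- the parametrization in the new coordinates
  set Q : L × D₀.ker → E := fun c => ψ (e.symm c) with hQ
  have hsymm : ∀ z ∈ Metric.ball z₀ r, ∀ m ∈ Metric.ball m₀ r, ContDiffAt ℝ ∞ e.symm (z, m) := by
    intro z hz m hm
    obtain ⟨h1, h2⟩ := hballmem z hz m hm
    obtain ⟨⟨e', he'⟩, h3, -⟩ := hW _ h2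
    refine e.contDiffAt_symm h1 (f₀' := e') ?_ (hΦ.contDiffAt (hN.mem_nhds h3))
    rw [he']
    exact hΦd _ h3
  have hQc : ∀ z ∈ Metric.ball z₀ r, ∀ m ∈ Metric.ball m₀ r, ContDiffAt ℝ ∞ Q (z, m) := by
    intro z hz m hm
    have h3 := (hW _ (hballmem z hz m hm).2).2.1
    exact ContDiffAt.comp (z, m) (hψ.contDiffAt (hN.mem_nhds h3)) (hsymm z hz m hm)
  have hπQ : ∀ z ∈ Metric.ball z₀ r, ∀ m ∈ Metric.ball m₀ r, π (Q (z, m)) = z := by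
    intro z hz m hm
    exact congrArg Prod.fst (e.right_inv (hballmem z hz m hm).1)
  have hQd : ∀ z ∈ Metric.ball z₀ r, ∀ m ∈ Metric.ball m₀ r, ∀ c,
      (∃ a, fderiv ℝ Q (z, m) c = fderiv ℝ ψ (e.symm (z, m)) a) ∧
      π (fderiv ℝ Q (z, m) c) = c.1 := by
    intro z hz m hm c
    have h3 := (hW _ (hballmem z hz m hm).2).2.1
    have h4 : HasFDerivAt e.symm (fderiv ℝ e.symm (z, m)) (z, m) :=
      ((hsymm z hz m hm).differentiableAt (by simp)).hasFDerivAt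
    have h5 : fderiv ℝ Q (z, m) = (fderiv ℝ ψ (e.symm (z, m))).comp (fderiv ℝ e.symm (z, m)) :=
      ((hψd _ h3).comp (z, m) h4).fderiv
    refine ⟨⟨fderiv ℝ e.symm (z, m) c, by rw [h5]; rfl⟩, ?_⟩
    have h6 : HasFDerivAt Q (fderiv ℝ Q (z, m)) (z, m) :=
      ((hQc z hz m hm).differentiableAt (by simp)).hasFDerivAt
    have h7 : HasFDerivAt (fun c => πR (Q c)) (πR.comp (fderiv ℝ Q (z, m))) (z, m) :=
      πR.hasFDerivAt.comp (z, m) h6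
    have h8 : (fun c => πR (Q c)) =ᶠ[𝓝 (z, m)] Prod.fst := by
      have h9 : (Metric.ball z₀ r ×ˢ Metric.ball m₀ r) ∈ 𝓝 (z, m) :=
        (Metric.isOpen_ball.prod Metric.isOpen_ball).mem_nhds ⟨hz, hm⟩
      filter_upwards [h9] with c hc
      exact hπQ c.1 hc.1 c.2 hc.2
    have h10 := h7.unique (hasFDerivAt_fst.congr_of_eventuallyEq h8)
    exact congrArg (fun D : L × D₀.ker →L[ℝ] L => D c) h10
  -- `π` maps the image of the derivative onto `L`, hence injectively, as the dimensions agree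
  have hinj : ∀ z ∈ Metric.ball z₀ r, ∀ m ∈ Metric.ball m₀ r, ∀ a,
      π (fderiv ℝ ψ (e.symm (z, m)) a) = 0 → fderiv ℝ ψ (e.symm (z, m)) a = 0 := by
    intro z hz m hm a ha
    have h3 := (hW _ (hballmem z hz m hm).2).2.1
    let R := LinearMap.range (fderiv ℝ ψ (e.symm (z, m)) : F →ₗ[ℝ] E)
    let ρ : R →ₗ[ℝ] L := (πR : E →ₗ[ℝ] L).comp R.subtype
    have h4 : Function.Surjective ρ := by
      intro l
      obtain ⟨⟨b, hb⟩, h5⟩ := hQd z hz m hm (l, 0)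
      refine ⟨⟨fderiv ℝ ψ (e.symm (z, m)) b, ⟨b, rfl⟩⟩, ?_⟩
      rw [hb] at h5
      exact h5
    have h5 : Function.Injective ρ :=
      (LinearMap.injective_iff_surjective_of_finrank_eq_finrank (hr _ h3)).2 h4
    have h6 := (injective_iff_map_eq_zero ρ).1 h5 ⟨fderiv ℝ ψ (e.symm (z, m)) a, ⟨a, rfl⟩⟩ ha
    exact congrArg Subtype.val h6
  -- hence `ψ` depends, in the new coordinates, on the first component only
  have hconst : ∀ z ∈ Metric.ball z₀ r, ∀ m ∈ Metric.ball m₀ r, Q (z, m) = Q (z, m₀) := by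
    intro z hz m hm
    have h1 : ∀ m ∈ Metric.ball m₀ r, HasFDerivAt (fun m => Q (z, m)) (0 : D₀.ker →L[ℝ] E) m := by
      intro m hm
      have h2 := ((hQc z hz m hm).differentiableAt (by simp)).hasFDerivAt.comp
        (f := fun m => (z, m)) m (hasFDerivAt_prodMk_right z m)
      refine h2.congr_fderiv ?_
      ext1 b
      obtain ⟨⟨a, ha⟩, h5⟩ := hQd z hz m hm (0, b)
      change fderiv ℝ Q (z, m) (0, b) = 0
      rw [ha] at h5 ⊢
      exact hinj z hz m hm a h5
    exact Metric.isOpen_ball.is_const_of_fderiv_eq_zero (convex_ball m₀ r).isPreconnected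
      (f := fun m => Q (z, m)) (𝕜 := ℝ)
      (fun m hm => (h1 m hm).differentiableAt.differentiableWithinAt)
      (fun m hm => (h1 m hm).fderiv) hm (Metric.mem_ball_self hr0)
  -- the slice is the graph of a holomorphic map
  set s : L → E := fun z => Q (z, m₀) with hs
  have hm₀' : m₀ ∈ Metric.ball m₀ r := Metric.mem_ball_self hr0
  have hsc : ContDiffOn ℝ ∞ s (Metric.ball z₀ r) := by
    intro z hz
    have h1 : ContDiffAt ℝ ∞ (fun z : L => (z, m₀)) z := by fun_prop
    exact (ContDiffAt.comp z (hQc z hz m₀ hm₀') h1).contDiffWithinAt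
  have hsd : ∀ z ∈ Metric.ball z₀ r, ∀ a, fderiv ℝ s z a = fderiv ℝ Q (z, m₀) (a, 0) := by
    intro z hz a
    have h2 := ((hQc z hz m₀ hm₀').differentiableAt (by simp)).hasFDerivAt.comp
        (f := fun z => (z, m₀)) z (hasFDerivAt_prodMk_left z m₀)
    have h3 : fderiv ℝ s z = _ := h2.fderiv
    rw [h3]
    rfl
  have hshol : ContDiffOn ℂ ∞ s (Metric.ball z₀ r) := by
    refine contDiffOn_complex_of_real Metric.isOpen_ball hsc fun z hz a => ?_
    rw [hsd z hz, hsd z hz]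
    obtain ⟨⟨b₁, h1⟩, h2⟩ := hQd z hz m₀ hm₀' (Complex.I • a, 0)
    obtain ⟨⟨b₂, h3⟩, h4⟩ := hQd z hz m₀ hm₀' (a, 0)
    obtain ⟨b₃, h5⟩ := hc _ (hW _ (hballmem z hz m₀ hm₀').2).2.1 b₂
    have h6 : π (fderiv ℝ ψ (e.symm (z, m₀)) (b₁ - b₃)) = 0 := by
      rw [map_sub, ← h5, ← h1, ← h3, map_sub, map_smul, h2, h4, sub_self]
    have h7 := hinj z hz m₀ hm₀' _ h6
    rw [map_sub, ← h5, ← h1, ← h3] at h7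
    exact sub_eq_zero.1 h7
  have hπs : ∀ z ∈ Metric.ball z₀ r, π (s z) = z := fun z hz => hπQ z hz m₀ hm₀'
  have hO : IsOpen (π ⁻¹' Metric.ball z₀ r) := Metric.isOpen_ball.preimage π.continuous
  have hsπ : ContDiffOn ℂ ∞ (fun p => s (π p)) (π ⁻¹' Metric.ball z₀ r) :=
    hshol.comp π.contDiff.contDiffOn (fun p hp => hp)
  have hπL : ContDiff ℂ ∞ (fun p => (π p : E)) := (L.subtypeL.comp π).contDiff
  have hΘ₁ : ContDiffOn ℂ ∞ (fun p => p - s (π p) + π p) (π ⁻¹' Metric.ball z₀ r) :=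
    (contDiffOn_id.sub hsπ).add hπL.contDiffOn
  have hΘ₂ : ContDiffOn ℂ ∞ (fun p => p + s (π p) - π p) (π ⁻¹' Metric.ball z₀ r) :=
    (contDiffOn_id.add hsπ).sub hπL.contDiffOn
  have hπ₁ : ∀ p, π p ∈ Metric.ball z₀ r → π (p - s (π p) + π p) = π p := by
    intro p hp
    rw [map_add, map_sub, hπs _ hp, hπ, sub_self, zero_add]
  have hπ₂ : ∀ p, π p ∈ Metric.ball z₀ r → π (p + s (π p) - π p) = π p := by
    intro p hp
    rw [map_sub, map_add, hπs _ hp, hπ, add_sub_cancel_right]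
  let Θ : OpenPartialHomeomorph E E :=
    { toFun := fun p => p - s (π p) + π p
      invFun := fun p => p + s (π p) - π p
      source := π ⁻¹' Metric.ball z₀ r
      target := π ⁻¹' Metric.ball z₀ r
      map_source' := fun p hp => by
        change π (p - s (π p) + π p) ∈ Metric.ball z₀ r
        rw [hπ₁ p hp]
        exact hp
      map_target' := fun p hp => by
        change π (p + s (π p) - π p) ∈ Metric.ball z₀ r
        rw [hπ₂ p hp]
        exact hp
      left_inv' := fun p hp => by
        rw [hπ₁ p hp]
        abel
      right_inv' := fun p hp => by
        rw [hπ₂ p hp]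
        abel
      open_source := hO
      open_target := hO
      continuousOn_toFun := hΘ₁.continuousOn
      continuousOn_invFun := hΘ₂.continuousOn }
  let U : Set F := e.source ∩ e ⁻¹' Metric.ball (z₀, m₀) r
  have hU : ∀ u ∈ U, u ∈ W ∧ π (ψ u) ∈ Metric.ball z₀ r ∧ ψ u = s (π (ψ u)) := by
    rintro u ⟨hu1, hu2⟩
    have h1 : (π (ψ u), q u) ∈ Metric.ball z₀ r ×ˢ Metric.ball m₀ r := by
      rw [ball_prod_same]
      exact hu2
    have h2 : e.symm (π (ψ u), q u) = u := e.left_inv hu1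
    refine ⟨?_, h1.1, ?_⟩
    · rw [← h2]
      exact (hballmem _ h1.1 _ h1.2).2
    · have h3 := hconst _ h1.1 _ h1.2
      rw [hQ] at h3
      simp only [h2] at h3
      exact h3
  refine ⟨Θ, U, e.isOpen_inter_preimage Metric.isOpen_ball, ⟨hu₀e, Metric.mem_ball_self hr0⟩,
    fun u hu => (hW u (hU u hu).1).2.1, hΘ₁, hΘ₂, ?_, ?_⟩
  · rintro _ ⟨u, hu, rfl⟩
    exact (hU u hu).2.1
  · apply Set.Subset.antisymm
    · rintro _ ⟨_, ⟨u, hu, rfl⟩, rfl⟩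
      obtain ⟨-, h1, h2⟩ := hU u hu
      refine ⟨Θ.map_source h1, ?_⟩
      change ψ u - s (π (ψ u)) + π (ψ u) ∈ (L : Set E)
      rw [← h2, sub_self, zero_add]
      exact (π (ψ u)).2
    · rintro l ⟨h1, h2⟩
      have h3 : π l = ⟨l, h2⟩ := hπ ⟨l, h2⟩
      have h4 : (⟨l, h2⟩ : L) ∈ Metric.ball z₀ r := by
        rw [← h3]
        exact h1
      obtain ⟨h5, h6⟩ := hballmem _ h4 m₀ hm₀'
      have h7 : e.symm (⟨l, h2⟩, m₀) ∈ U := by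
        refine ⟨e.map_target h5, ?_⟩
        change e (e.symm (⟨l, h2⟩, m₀)) ∈ Metric.ball (z₀, m₀) r
        rw [e.right_inv h5, ← ball_prod_same]
        exact ⟨h4, hm₀'⟩
      refine ⟨_, ⟨_, h7, rfl⟩, ?_⟩
      have h8 : ψ (e.symm (⟨l, h2⟩, m₀)) = s ⟨l, h2⟩ := rfl
      change ψ (e.symm (⟨l, h2⟩, m₀)) - s (π (ψ (e.symm (⟨l, h2⟩, m₀))))
        + π (ψ (e.symm (⟨l, h2⟩, m₀))) = l
      rw [h8, hπs _ h4, sub_self, zero_add]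

/-! ### The orbit as a complex submanifold -/

/-- A smooth map of complex manifolds with complex linear derivatives is holomorphic. -/
theorem ContMDiff.complex_of_real {E : Type*} [NormedAddCommGroup E] [NormedSpace ℂ E]
    [FiniteDimensional ℂ E] {M : Type*} [TopologicalSpace M] [ChartedSpace E M]
    [IsManifold 𝓘(ℂ, E) ∞ M] {f : M → M} (hf : ContMDiff 𝓘(ℝ, E) 𝓘(ℝ, E) ∞ f)
    (hI : ∀ y (v : E), (modelDeriv f y (Complex.I • v) : E) = Complex.I • modelDeriv f y v) :
    ContMDiff 𝓘(ℂ, E) 𝓘(ℂ, E) ∞ f := by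
  intro x
  rw [contMDiffAt_iff]
  refine ⟨hf.continuous.continuousAt, ?_⟩
  set φ := extChartAt 𝓘(ℝ, E) x with hφ
  set φ' := extChartAt 𝓘(ℝ, E) (f x) with hφ'
  let O : Set E := φ.target ∩ φ.symm ⁻¹' (f ⁻¹' φ'.source)
  have hO : IsOpen O := (continuousOn_extChartAt_symm x).isOpen_inter_preimage
    (isOpen_extChartAt_target x) ((isOpen_extChartAt_source (f x)).preimage hf.continuous)
  have hmem : φ x ∈ O := by
    refine ⟨mem_extChartAt_target x, ?_⟩
    change f (φ.symm (φ x)) ∈ φ'.source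
    rw [hφ, extChartAt_to_inv]
    exact mem_extChartAt_source (f x)
  have hsm : ∀ q ∈ O, ContMDiffAt 𝓘(ℝ, E) 𝓘(ℝ, E) ∞ (fun q => φ' (f (φ.symm q))) q := by
    intro q hq
    have h1 : ContMDiffAt 𝓘(ℝ, E) 𝓘(ℝ, E) ∞ φ.symm q :=
      (contMDiffOn_extChartAt_symm x).contMDiffAt ((isOpen_extChartAt_target x).mem_nhds hq.1)
    have h2 : ContMDiffAt 𝓘(ℝ, E) 𝓘(ℝ, E) ∞ φ' (f (φ.symm q)) :=
      contMDiffAt_extChartAt' (by simpa [hφ'] using hq.2)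
    exact h2.comp q (hf.contMDiffAt.comp q h1)
  have hreal : ContDiffOn ℝ ∞ (fun q => φ' (f (φ.symm q))) O := fun q hq =>
    (hsm q hq).contDiffAt.contDiffWithinAt
  have hcomplex : ContDiffOn ℂ ∞ (fun q => φ' (f (φ.symm q))) O := by
    refine contDiffOn_complex_of_real hO hreal fun q hq v => ?_
    have h2 := mdifferentiableAt_extChartAt_symm_real hq.1
    have h3 : MDifferentiableAt 𝓘(ℝ, E) 𝓘(ℝ, E) f (φ.symm q) :=
      hf.contMDiffAt.mdifferentiableAt (by simp)
    have h4 : MDifferentiableAt 𝓘(ℝ, E) 𝓘(ℝ, E) φ' (f (φ.symm q)) :=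
      mdifferentiableAt_extChartAt (by simpa [hφ'] using hq.2)
    have h5 : ∀ v : E, fderiv ℝ (fun q => φ' (f (φ.symm q))) q v
        = modelDeriv (W := E) φ' (f (φ.symm q)) (modelDeriv (W := E) f (φ.symm q)
          (modelDeriv (W := E) φ.symm q v)) := by
      intro v
      have e1 := modelDeriv_comp q h4 (h3.comp q h2)
      have e2 := modelDeriv_comp q h3 h2
      rw [← modelDeriv_eq_fderiv]
      refine (congrArg (fun D : E →L[ℝ] E => D v) e1).trans ?_
      exact congrArg (fun D : E →L[ℝ] E => modelDeriv (W := E) φ' (f (φ.symm q)) (D v)) e2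
    rw [h5, h5, modelDeriv_extChartAt_symm_smul_I hq.1, hI, modelDeriv_extChartAt_smul_I hq.2]
  exact (hcomplex.contDiffAt (hO.mem_nhds hmem)).contDiffWithinAt

/-- For a compact group, the points of an orbit near `x` come from group elements near `1`: the
orbit carries the quotient topology. The translates of `W` by the stabilizer of `x` cover an open
neighbourhood of it, whose complement is compact and has a closed image that misses `x`. -/
theorem exists_nhds_orbit_subset {K M : Type*} [TopologicalSpace K] [Group K] [IsTopologicalGroup K]
    [CompactSpace K] [TopologicalSpace M] [T2Space M] [MulAction K M] {x : M}
    (hcont : Continuous fun k : K => k • x) {W : Set K} (hW : W ∈ 𝓝 1) :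
    ∃ V : Set M, IsOpen V ∧ x ∈ V ∧ ∀ k : K, k • x ∈ V → ∃ w ∈ W, k • x = w • x := by
  obtain ⟨W', hW'W, hW'o, h1⟩ := mem_nhds_iff.1 hW
  let O : Set K := ⋃ s ∈ MulAction.stabilizer K x, (fun k => k * s⁻¹) ⁻¹' W'
  have hO : IsOpen O := isOpen_biUnion fun s _ => hW'o.preimage (continuous_mul_const _)
  have hC : IsCompact ((fun k : K => k • x) '' Oᶜ) := hO.isClosed_compl.isCompact.image hcont
  refine ⟨((fun k : K => k • x) '' Oᶜ)ᶜ, hC.isClosed.isOpen_compl, ?_, ?_⟩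
  · rintro ⟨k, hk, hkx⟩
    refine hk (Set.mem_biUnion (x := k) hkx ?_)
    simpa using h1
  · intro k hk
    have h2 : k ∈ O := by
      by_contra hcon
      exact hk ⟨k, hcon, rfl⟩
    obtain ⟨s, hs, hks⟩ := Set.mem_iUnion₂.1 h2
    refine ⟨k * s⁻¹, hW'W hks, ?_⟩
    have h3 : s⁻¹ • x = x := by
      rw [inv_smul_eq_iff]
      exact (MulAction.mem_stabilizer_iff.1 hs).symm
    rw [mul_smul, h3]

section orbit
variable {E : Type*} [NormedAddCommGroup E] [NormedSpace ℂ E]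
  {M : Type*} [TopologicalSpace M] [ChartedSpace E M]
  {F : Type*} [NormedAddCommGroup F] [NormedSpace ℝ F]
  {K : Type*} [TopologicalSpace K] [ChartedSpace F K] [Group K] [LieGroup 𝓘(ℝ, F) ∞ K]
  [MulAction K M] [ContMDiffSMul 𝓘(ℝ, F) 𝓘(ℝ, E) ∞ K M]

/-- The derivative of the equivariance `(k h) • x = k • (h • x)` of the orbit map, in the variable
`h`. -/
theorem modelDeriv_orbit_mul (k h : K) (x : M) (a : F) :
    (modelDeriv (W := E) (fun h : K => h • x) (k * h)
        (modelDeriv (W := F) (fun h => k * h) h a) : E)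
      = modelDeriv (W := E) (fun y : M => k • y) (h • x)
        (modelDeriv (W := E) (fun h : K => h • x) h a) := by
  have h0 : MDifferentiableAt 𝓘(ℝ, F) 𝓘(ℝ, F) (fun h : K => k * h) h :=
    ((contMDiff_mul_left (I := 𝓘(ℝ, F)) (n := ∞) (a := k)).contMDiffAt).mdifferentiableAt (by simp)
  have h1 := modelDeriv_comp h (mdifferentiableAt_smul_const (F := F) (E := E) (k * h) x) h0
  have h2 := modelDeriv_comp h (mdifferentiableAt_const_smul (E := E) F k (h • x))
    (mdifferentiableAt_smul_const (F := F) (E := E) h x)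
  have h3 := congrArg (fun D : F →L[ℝ] E => D a) h1
  have h4 := congrArg (fun D : F →L[ℝ] E => D a) h2
  simp only [mul_smul] at h3
  exact h3.symm.trans h4

end orbit

section
variable {E : Type*} [NormedAddCommGroup E] [NormedSpace ℂ E] [FiniteDimensional ℂ E]
  {M : Type*} [TopologicalSpace M] [T2Space M] [ChartedSpace E M] [IsManifold 𝓘(ℂ, E) ∞ M]
  {F : Type*} [NormedAddCommGroup F] [NormedSpace ℝ F] [FiniteDimensional ℝ F]
  {K : Type*} [TopologicalSpace K] [CompactSpace K] [ChartedSpace F K] [Group K]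
  [LieGroup 𝓘(ℝ, F) ∞ K] [MulAction K M] [ContMDiffSMul 𝓘(ℝ, F) 𝓘(ℝ, E) ∞ K M]

/-- For a holomorphic action of a compact group, an orbit whose tangent space at one point is
complex is a complex submanifold: the orbit map has constant rank and complex tangent spaces by
equivariance, and `exists_nhds_orbit_subset` excludes that other parts of the orbit accumulate at
`x`. The holomorphic slice chart at `x` is translated to the other points of the orbit. -/
theorem isComplexSubmanifold_orbit
    (hI : ∀ (k : K) (y : M) (v : E), (modelDeriv (fun z : M => k • z) y (Complex.I • v) : E)
      = Complex.I • modelDeriv (fun z : M => k • z) y v)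
    (x : M) (hx : ∀ ξ : F, ∃ η : F, Complex.I • modelDeriv (W := E) (fun k : K => k • x) 1 ξ
      = modelDeriv (W := E) (fun k : K => k • x) 1 η) :
    IsComplexSubmanifold E (MulAction.orbit K x) := by
  have hfin : FiniteDimensional ℝ E := FiniteDimensional.complexToReal E
  have hK := isManifold_one_of_lieGroup (F := F) (K := K)
  have htop : IsTopologicalGroup K := topologicalGroup_of_lieGroup 𝓘(ℝ, F) ∞
  set φ := extChartAt 𝓘(ℝ, E) x with hφ
  set κ := extChartAt 𝓘(ℝ, F) (1 : K) with hκ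
  have hp : φ x ∈ φ.target := mem_extChartAt_target (I := 𝓘(ℝ, E)) x
  have hφx : φ.symm (φ x) = x := extChartAt_to_inv x
  let o : F →L[ℝ] E := modelDeriv (W := E) (fun k : K => k • x) 1
  let L : Submodule ℂ E :=
    { carrier := Set.range o
      add_mem' := by
        rintro _ _ ⟨a, rfl⟩ ⟨b, rfl⟩
        exact ⟨a + b, map_add _ _ _⟩
      zero_mem' := ⟨0, map_zero _⟩
      smul_mem' := by
        rintro c _ ⟨a, rfl⟩
        obtain ⟨b, hb⟩ := hx a
        refine ⟨c.re • a + c.im • b, ?_⟩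
        have hb' : o b = Complex.I • o a := hb.symm
        rw [map_add, map_smul, map_smul, hb']
        conv_rhs => rw [← Complex.re_add_im c]
        rw [add_smul, mul_smul, Complex.coe_smul, Complex.coe_smul] }
  let N : Set F := κ.target ∩ κ.symm ⁻¹' ((fun k : K => k • x) ⁻¹' φ.source)
  have hcont : Continuous fun k : K => k • x := continuous_iff_continuousAt.2 fun k =>
    (mdifferentiableAt_smul_const (F := F) (E := E) k x).continuousAt
  have hN : IsOpen N := (continuousOn_extChartAt_symm (1 : K)).isOpen_inter_preimage
    (isOpen_extChartAt_target (1 : K)) ((isOpen_extChartAt_source x).preimage hcont)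
  have hu₀ : κ 1 ∈ N := by
    refine ⟨mem_extChartAt_target (1 : K), ?_⟩
    change κ.symm (κ 1) • x ∈ φ.source
    rw [hκ, extChartAt_to_inv, one_smul]
    exact mem_extChartAt_source x
  let ψ : F → E := fun u => actionInChart (E := E) F K x (u, φ x)
  have hψΨ : ∀ u ∈ N, ContDiffAt ℝ ∞ (actionInChart (E := E) F K x) (u, φ x) := by
    intro u hu
    refine contDiffAt_actionInChart hu.1 hp ?_
    rw [← hφ, hφx]
    exact hu.2
  have hψ : ContDiffOn ℝ ∞ ψ N := by
    intro u hu
    have h1 : ContDiffAt ℝ ∞ (fun u : F => (u, φ x)) u := by fun_prop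
    exact (ContDiffAt.comp u (hψΨ u hu) h1).contDiffWithinAt
  have hψval : ∀ u, ψ u = φ (κ.symm u • x) := by
    intro u
    change φ (κ.symm u • φ.symm (φ x)) = _
    rw [hφx]
  -- the derivative of `ψ` at `u` has as its image that of `o` under the complex isomorphism `C u`
  let C : F → E →L[ℝ] E := fun u => (modelDeriv (W := E) φ (κ.symm u • x)).comp
    (modelDeriv (W := E) (fun y : M => κ.symm u • y) x)
  have hψd : ∀ u ∈ N, ∀ a, fderiv ℝ ψ u a = modelDeriv (W := E) φ (κ.symm u • x)
      (modelDeriv (W := E) (fun k : K => k • x) (κ.symm u) (modelDeriv (W := F) κ.symm u a)) := by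
    intro u hu a
    have h1 := ((hψΨ u hu).differentiableAt (by simp)).hasFDerivAt.comp
      (f := fun a => (a, φ x)) u (hasFDerivAt_prodMk_left u (φ x))
    have h2 : fderiv ℝ ψ u = _ := h1.fderiv
    rw [h2]
    have h3 := fderiv_actionInChart_left hu.1 hp (by rw [← hφ, hφx]; exact hu.2) a
    rw [← hφ, hφx] at h3
    exact h3
  have hCI : ∀ u ∈ N, ∀ v, C u (Complex.I • v) = Complex.I • C u v := by
    intro u hu v
    change modelDeriv (W := E) φ _ (modelDeriv (W := E) _ x _) = _
    rw [hI, modelDeriv_extChartAt_smul_I hu.2]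
    rfl
  have hCinj : ∀ u ∈ N, Function.Injective (C u) := by
    intro u hu
    rw [injective_iff_map_eq_zero]
    intro v hv
    have h1 := modelDeriv_symm_modelDeriv_extChartAt hu.2
      (modelDeriv (W := E) (fun y : M => κ.symm u • y) x v)
    have h2 : modelDeriv (W := E) φ (κ.symm u • x)
      (modelDeriv (W := E) (fun y : M => κ.symm u • y) x v) = 0 := hv
    rw [h2, map_zero] at h1
    have h3 := modelDeriv_smul_mul F (κ.symm u) (κ.symm u)⁻¹ x v
    rw [← h1, map_zero, inv_mul_cancel] at h3
    simp only [one_smul] at h3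
    rw [← h3]
    exact congrArg (fun D : E →L[ℝ] E => D v) (mfderiv_id (I := 𝓘(ℝ, E)) (x := x)).symm
  have hC₁ : ∀ u ∈ N, ∀ a, ∃ b, fderiv ℝ ψ u a = C u (o b) := by
    intro u hu a
    set k := κ.symm u
    refine ⟨modelDeriv (W := F) (fun h => k⁻¹ * h) k (modelDeriv (W := F) κ.symm u a), ?_⟩
    rw [hψd u hu]
    have h1 := modelDeriv_orbit_mul (E := E) k⁻¹ k x (modelDeriv (W := F) κ.symm u a)
    rw [inv_mul_cancel] at h1
    have h2 := modelDeriv_smul_mul F k⁻¹ k (k • x)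
      (modelDeriv (W := E) (fun k : K => k • x) k (modelDeriv (W := F) κ.symm u a))
    rw [inv_smul_smul, mul_inv_cancel, ← h1] at h2
    simp only [one_smul] at h2
    refine congrArg (modelDeriv (W := E) φ (k • x)) ?_
    refine Eq.trans ?_ h2
    exact congrArg (fun D : E →L[ℝ] E => D _) (mfderiv_id (I := 𝓘(ℝ, E)) (x := k • x)).symm
  have hC₂ : ∀ u ∈ N, ∀ b, ∃ a, fderiv ℝ ψ u a = C u (o b) := by
    intro u hu b
    set k := κ.symm u with hk
    refine ⟨modelDeriv (W := F) κ k (modelDeriv (W := F) (fun h => k * h) 1 b), ?_⟩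
    have h0 : κ.symm u ∈ κ.source := κ.map_target hu.1
    have h1 := modelDeriv_symm_modelDeriv_extChartAt h0 (modelDeriv (W := F) (fun h => k * h) 1 b)
    rw [← hκ, κ.right_inv hu.1] at h1
    rw [hψd u hu, ← hk, h1]
    have h2 := modelDeriv_orbit_mul (E := E) k 1 x b
    rw [mul_one, one_smul] at h2
    exact congrArg (modelDeriv (W := E) φ (k • x)) h2
  have hrange : ∀ u ∈ N, LinearMap.range (fderiv ℝ ψ u : F →ₗ[ℝ] E)
      = (L.restrictScalars ℝ).map (C u : E →ₗ[ℝ] E) := by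
    intro u hu
    ext v
    constructor
    · rintro ⟨a, rfl⟩
      obtain ⟨b, hb⟩ := hC₁ u hu a
      exact ⟨o b, ⟨b, rfl⟩, hb.symm⟩
    · rintro ⟨_, ⟨b, rfl⟩, rfl⟩
      exact hC₂ u hu b
  have hψ₀ : ∀ a, fderiv ℝ ψ (κ 1) a = o a := by
    intro a
    have h1 := ((hψΨ _ hu₀).differentiableAt (by simp)).hasFDerivAt.comp
      (f := fun a => (a, φ x)) (κ 1) (hasFDerivAt_prodMk_left (κ 1) (φ x))
    have h2 : fderiv ℝ ψ (κ 1) = _ := h1.fderiv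
    rw [h2]
    have h3 := fderiv_actionInChart_one (F := F) (K := K) hp a
    rw [← hφ, hφx] at h3
    refine h3.trans ?_
    exact congrArg (fun D : E →L[ℝ] E => D _) (mfderiv_extChartAt_self (I := 𝓘(ℝ, E)))
  obtain ⟨Θ, U, hUo, hu₀U, hUN, hΘ₁, hΘ₂, hΘs, hΘim⟩ :=
    exists_holomorphic_straightening hN hu₀ hψ L
      (fun v => ⟨fun ⟨a, ha⟩ => ⟨a, (hψ₀ a).trans ha⟩, fun ⟨a, ha⟩ => ⟨a, (hψ₀ a).symm.trans ha⟩⟩)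
      (fun u hu a => by
        obtain ⟨b, hb⟩ := hC₁ u hu a
        obtain ⟨c, hc⟩ := hx b
        obtain ⟨d, hd⟩ := hC₂ u hu c
        refine ⟨d, ?_⟩
        rw [hd, hb, ← hCI u hu]
        exact congrArg (C u) hc)
      (fun u hu => by
        rw [hrange u hu]
        exact (Submodule.equivMapOfInjective (C u : E →ₗ[ℝ] E) (hCinj u hu)
          (L.restrictScalars ℝ)).finrank_eq.symm)
  let W : Set K := κ.source ∩ κ ⁻¹' U
  have hW : W ∈ 𝓝 (1 : K) := inter_mem (extChartAt_source_mem_nhds 1)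
    ((continuousAt_extChartAt (1 : K)).preimage_mem_nhds (hUo.mem_nhds hu₀U))
  obtain ⟨V, hVo, hxV, hV⟩ := exists_nhds_orbit_subset hcont hW
  -- the slice chart at `x`
  let c : OpenPartialHomeomorph M E := ((chartAt E x).restrOpen V hVo).trans Θ
  have hcsource : ∀ y, y ∈ c.source ↔ (y ∈ φ.source ∧ y ∈ V) ∧ φ y ∈ Θ.source := by
    intro y
    simp [c, hφ]
  have hcval : ∀ y, c y = Θ (φ y) := fun y => rfl
  have hxc : x ∈ c.source := by
    rw [hcsource]
    refine ⟨⟨mem_extChartAt_source x, hxV⟩, hΘs ⟨κ 1, hu₀U, ?_⟩⟩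
    rw [hψval, hκ, extChartAt_to_inv, one_smul]
  have hcim : c '' (c.source ∩ MulAction.orbit K x) = c.target ∩ (L : Set E) := by
    apply Set.Subset.antisymm
    · rintro _ ⟨_, ⟨hy, ⟨k, rfl⟩⟩, rfl⟩
      refine ⟨c.map_source hy, ?_⟩
      have h1 := (hcsource _).1 hy
      obtain ⟨w, hw, hkw⟩ := hV k h1.1.2
      have h2 : Θ (φ (k • x)) ∈ Θ '' (ψ '' U) := by
        refine ⟨_, ⟨κ w, hw.2, rfl⟩, ?_⟩
        rw [hψval, κ.left_inv hw.1, hkw]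
      rw [hΘim] at h2
      exact h2.2
    · rintro l ⟨hl1, hl2⟩
      have h1 : c.symm l ∈ c.source := c.map_target hl1
      have h2 := (hcsource _).1 h1
      have h3 : Θ (φ (c.symm l)) = l := c.right_inv hl1
      have h4 : l ∈ Θ '' (ψ '' U) := by
        rw [hΘim]
        refine ⟨?_, hl2⟩
        rw [← h3]
        exact Θ.map_source h2.2
      obtain ⟨_, ⟨u, hu, rfl⟩, hul⟩ := h4
      have h5 : ψ u = φ (c.symm l) := Θ.injOn (hΘs ⟨u, hu, rfl⟩) h2.2 (hul.trans h3.symm)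
      rw [hψval] at h5
      have h6 : κ.symm u • x = c.symm l := φ.injOn (hUN hu).2 h2.1.1 h5
      refine ⟨c.symm l, ⟨h1, ?_⟩, c.right_inv hl1⟩
      rw [← h6]
      exact ⟨κ.symm u, rfl⟩
  have hc₁ : ContMDiffOn 𝓘(ℂ, E) 𝓘(ℂ, E) ∞ c c.source := by
    have h1 : ContMDiffOn 𝓘(ℂ, E) 𝓘(ℂ, E) ∞ (chartAt E x) (chartAt E x).source :=
      contMDiffOn_chart
    refine hΘ₁.contMDiffOn.comp (h1.mono fun y hy => ?_) fun y hy => ((hcsource y).1 hy).2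
    simpa [hφ] using ((hcsource y).1 hy).1.1
  have hc₂ : ContMDiffOn 𝓘(ℂ, E) 𝓘(ℂ, E) ∞ c.symm c.target := by
    have h1 : ContMDiffOn 𝓘(ℂ, E) 𝓘(ℂ, E) ∞ (chartAt E x).symm (chartAt E x).target :=
      contMDiffOn_chart_symm
    refine h1.comp (hΘ₂.contMDiffOn.mono fun l hl => ?_) fun l hl => ?_
    · simp [c] at hl
      exact hl.1
    · simp [c] at hl
      exact hl.2.1
  have hhol : ∀ k : K, ContMDiff 𝓘(ℂ, E) 𝓘(ℂ, E) ∞ (fun z : M => k • z) := fun k =>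
    (contMDiff_const_smul_real F k).complex_of_real (hI k)
  refine ⟨L, ?_⟩
  rintro _ ⟨k, rfl⟩
  -- the chart at `k • x` is the slice chart at `x` after the biholomorphic map `y ↦ k⁻¹ • y`
  let τ : M ≃ₜ M :=
    { toFun := fun y => k⁻¹ • y
      invFun := fun y => k • y
      left_inv := fun y => smul_inv_smul k y
      right_inv := fun y => inv_smul_smul k y
      continuous_toFun := (hhol k⁻¹).continuous
      continuous_invFun := (hhol k).continuous }
  let d : OpenPartialHomeomorph M E := τ.toOpenPartialHomeomorph.trans c
  have hdsource : ∀ y, y ∈ d.source ↔ k⁻¹ • y ∈ c.source := fun y => by simp [d, τ]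
  have hdtarget : d.target = c.target := by simp [d]
  refine ⟨d, OpenPartialHomeomorph.mem_maximalAtlas_of_contMDiffOn d ?_ ?_, ?_, ?_⟩
  · exact hc₁.comp (hhol k⁻¹).contMDiffOn fun y hy => (hdsource y).1 hy
  · rw [hdtarget]
    exact (hhol k).comp_contMDiffOn hc₂
  · rw [hdsource]
    simpa using hxc
  · rw [hdtarget, ← hcim]
    apply Set.Subset.antisymm
    · rintro _ ⟨y, ⟨hy, h, rfl⟩, rfl⟩
      exact ⟨k⁻¹ • h • x, ⟨(hdsource _).1 hy, ⟨k⁻¹ * h, mul_smul _ _ _⟩⟩, rfl⟩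
    · rintro _ ⟨y, ⟨hy, h, rfl⟩, rfl⟩
      refine ⟨k • h • x, ⟨(hdsource _).2 ?_, ⟨k * h, mul_smul _ _ _⟩⟩, ?_⟩
      · rwa [inv_smul_smul]
      · change c (k⁻¹ • k • h • x) = c (h • x)
        rw [inv_smul_smul]

end

theorem proposition4
    {E : Type*} [NormedAddCommGroup E] [NormedSpace ℂ E] [FiniteDimensional ℂ E]
    {M : Type*} [TopologicalSpace M] [T2Space M] [CompactSpace M]
    [ChartedSpace E M] [IsManifold 𝓘(ℂ, E) ∞ M]
    {F : Type*} [NormedAddCommGroup F] [NormedSpace ℝ F] [FiniteDimensional ℝ F]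
    {K : Type*} [TopologicalSpace K] [T2Space K] [CompactSpace K] [ConnectedSpace K]
    [ChartedSpace F K] [Group K] [LieGroup 𝓘(ℝ, F) ∞ K]
    [MulAction K M] [ContMDiffSMul 𝓘(ℝ, F) 𝓘(ℝ, E) ∞ K M]
    (g : KahlerMetric E M) (hg : IsIsometricAction K g.toHermitianMetric)
    (B : LinearMap.BilinForm ℝ (GroupLieAlgebra 𝓘(ℝ, F) K))
    (hB : IsInvariantScalarProduct F K B)
    (μ : M → GroupLieAlgebra 𝓘(ℝ, F) K)
    (hμ : IsMomentMap F g.toHermitianMetric (fun y => B (μ y)))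
    (x : M) (hx : ∀ y : M, B (μ y) (μ y) ≤ B (μ x) (μ x)) :
    IsComplexSubmanifold E (MulAction.orbit K x) :=
  isComplexSubmanifold_orbit (F := F)
    (fun k y v => modelDeriv_smul_complex g hg hμ y v k) x
    (orbit_tangent_complex_of_isMax g.toHermitianMetric hg B hB.symm hB.pos μ hμ x hx)
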